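/- Let $M$ be a smooth ($n$-dimensional, Hausdorff, second countable) manifold without boundary, and let $L:TM\to\mathbb R$ be a Tonelli Lagrangian, i.e. $L$ is smooth, superlinear on each fibre $T_qM$, and $d_{vv}L(q,v)$ is positive definite for every $(q,v)\in TM$. For $\kappa\in\mathbb R$ consider the free-period action functional $$\mathbb S_\kappa(x,T)=T\int_{\mathbb R/\mathbb Z}\bigl(L(x(s),\dot x(s)/T)+\kappa\bigr)\,ds,\qquad (x,T)\in C^\infty(\mathbb R/\mathbb Z,M)\times(0,\infty),$$ and, for fixed $T>0$, the fixed-period action functional $\mathbb S^T_\kappa(x)=\mathbb S_\kappa(x,T)$. A critical point of $\mathbb S_\kappa$ is a pair $(x,T)$ such that the derivative of $\mathbb S_\kappa$ vanishes along every smooth curve $r\mapsto(x_r,T_r)$ through $(x,T)$. At a critical point $(x,T)$ the second differential of $\mathbb S_\kappa$ is the quadratic form on the space of pairs $(\xi,\tau)$, with $\xi$ a smooth vector field along the loop $x$ and $\tau\in\mathbb R$, given by the second derivative of $\mathbb S_\kappa$ at $r=0$ along curves through $(x,T)$ with velocity $(\xi,\tau)$ at $r=0$; the second differential of $\mathbb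 S^T_\kappa$ at $x$ is defined in the same way on the space of smooth vector fields $\xi$ along $x$. Denote by $i(x,T)$ and $i_T(x)$ the Morse indices, i.e. the suprema of the dimensions of finite-dimensional linear spaces on which the second differential of $\mathbb S_\kappa$ at $(x,T)$, respectively of $\mathbb S^T_\kappa$ at $x$, is negative definite. A critical point $(x,T)$ is called transversally non-degenerate if $1$ is an eigenvalue of algebraic multiplicity exactly two of $d\varphi_T(\gamma(0),\dot\gamma(0))$, where $\gamma(t)=x(t/T)$ and $\varphi_t$ is the Lagrangian (Euler–Lagrange) flow of $L$ on $TM$. An orbit cylinder through a critical point $(x,T)$ of $\mathbb S_{\bar\kappa}$ is a smooth family $(x_\kappa,T(\kappa))$, $\kappa\in(\bar\kappa-\epsilon,\bar\kappa+\epsilon)$, with $\epsilon>0$, such that $(x_\kappa,T(\kappa))$ is a critical point of $\mathbb S_\kappa$ for every $\kappa$ and $(x_{\bar\kappa},T(\bar\kappa))=(x,T)$. **Proposition.** Let $(x,T)$ be a transversally non-degenerate critical point of $\mathbb S_{\bar\kappa}$, and let $(x_\kappa,T(\kappa))$, $\kappa\in(\bar\kappa-\epsilon,\bar\kappa+\epsilon)$,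 be an orbit cylinder through $(x,T)$. Then $$i(x,T)=\begin{cases} i_T(x)+1 & \text{if } T'(\bar\kappa)\ge 0,\\ i_T(x) & \text{if } T'(\bar\kappa)<0.\end{cases}$$ -/

import Mathlib

open Set Filter Topology Manifold
open scoped ContDiff

noncomputable section

namespace FreePeriod

/-- The model space of an `n`-dimensional manifold. -/
abbrev Model (n : ℕ) : Type := EuclideanSpace ℝ (Fin n)

variable {n : ℕ} {M : Type*} [TopologicalSpace M] [ChartedSpace (Model n) M]
  [IsManifold (𝓡 n) ∞ M]

/-- A Tonelli Lagrangian: a smooth function on `TM` that is superlinear on each fibre and whose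
second derivative along each fibre is positive definite everywhere. -/
structure IsTonelli (L : TangentBundle (𝓡 n) M → ℝ) : Prop where
  smooth : ContMDiff (𝓡 n).tangent 𝓘(ℝ, ℝ) ∞ L
  superlinear : ∀ q : M,
    Tendsto (fun v : Model n => L (⟨q, v⟩ : TangentBundle (𝓡 n) M) / ‖v‖) (cocompact (Model n)) atTop
  convex : ∀ (q : M) (v w : TangentSpace (𝓡 n) q), w ≠ 0 →
    0 < iteratedDeriv 2 (fun t : ℝ => L (⟨q, v + t • w⟩ : TangentBundle (𝓡 n) M)) 0

/-- The point `(c t, a ċ(t))` of `TM`, for a curve `c` in `M`, a time `t` and a factor `a`. -/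
def scaledVelocity (a : ℝ) (c : ℝ → M) (t : ℝ) : TangentBundle (𝓡 n) M :=
  ⟨c t, a • (mfderiv 𝓘(ℝ, ℝ) (𝓡 n) c t (1 : ℝ) : TangentSpace (𝓡 n) (c t))⟩

/-- The point `(c t, ċ(t))` of `TM`. -/
def velocity (c : ℝ → M) (t : ℝ) : TangentBundle (𝓡 n) M :=
  ⟨c t, (mfderiv 𝓘(ℝ, ℝ) (𝓡 n) c t (1 : ℝ) : TangentSpace (𝓡 n) (c t))⟩

/-- The free-period action `S_κ(x, T) = T ∫_{ℝ/ℤ} (L(x(s), ẋ(s)/T) + κ) ds`. Loops `ℝ/ℤ → M` are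
represented by `1`-periodic maps `ℝ → M`. -/
def action (L : TangentBundle (𝓡 n) M → ℝ) (κ : ℝ) (x : ℝ → M) (T : ℝ) : ℝ :=
  T * ∫ s in (0 : ℝ)..1, (L (scaledVelocity T⁻¹ x s) + κ)

/-! ### Smooth loops, variations and vector fields along a loop -/

variable (n) in
/-- `x` is a smooth loop `ℝ/ℤ → M`. -/
structure IsSmoothLoop (x : ℝ → M) : Prop where
  smooth : ContMDiff 𝓘(ℝ, ℝ) (𝓡 n) ∞ x
  periodic : Function.Periodic x 1

variable (n) in
/-- `r ↦ u r` is a smooth one-parameter family of loops, defined for `r` close to `0`, with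
`u 0 = x`: a smooth curve through `x` in the space of loops. -/
structure IsVariation (x : ℝ → M) (u : ℝ → ℝ → M) : Prop where
  start : u 0 = x
  smooth : ∃ δ > 0, (∀ r ∈ Ioo (-δ) δ, Function.Periodic (u r) 1) ∧
    ContMDiffOn 𝓘(ℝ, ℝ × ℝ) (𝓡 n) ∞ (fun p : ℝ × ℝ => u p.1 p.2) (Ioo (-δ) δ ×ˢ univ)

/-- `r ↦ θ r` is a smooth curve of periods, defined for `r` close to `0`, with `θ 0 = T`. -/
structure IsPeriodVariation (T : ℝ) (θ : ℝ → ℝ) : Prop where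
  start : θ 0 = T
  smooth : ∃ δ > 0, ContDiffOn ℝ ∞ θ (Ioo (-δ) δ)

/-- `ξ` is a smooth vector field along the loop `x`, i.e. a tangent vector at `x` to the space
of loops. -/
structure IsFieldAlong (x : ℝ → M) (ξ : (s : ℝ) → TangentSpace (𝓡 n) (x s)) : Prop where
  smooth : ContMDiff 𝓘(ℝ, ℝ) (𝓡 n).tangent ∞
    (fun s => (⟨x s, ξ s⟩ : TangentBundle (𝓡 n) M))
  periodic : Function.Periodic (fun s => (⟨x s, ξ s⟩ : TangentBundle (𝓡 n) M)) 1

/-- The variation `u` of `x` has velocity `ξ` at `r = 0`. -/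
def HasVariationField (x : ℝ → M) (u : ℝ → ℝ → M) (ξ : (s : ℝ) → TangentSpace (𝓡 n) (x s)) :
    Prop :=
  ∀ s, velocity (fun r => u r s) 0 = (⟨x s, ξ s⟩ : TangentBundle (𝓡 n) M)

/-! ### Critical points and Morse indices -/

/-- `(x, T)` is a critical point of the free-period action functional `S_κ` on
`C^∞(ℝ/ℤ, M) × (0, ∞)`: the differential of `S_κ` vanishes along every smooth curve through
`(x, T)`. -/
structure IsCriticalPoint (L : TangentBundle (𝓡 n) M → ℝ) (κ : ℝ) (x : ℝ → M) (T : ℝ) : Prop where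
  loop : IsSmoothLoop n x
  pos : 0 < T
  critical : ∀ (u : ℝ → ℝ → M) (θ : ℝ → ℝ), IsVariation n x u → IsPeriodVariation T θ →
    HasDerivAt (fun r => action L κ (u r) (θ r)) 0 0

/-- The second differential of `S_κ` at the critical point `(x, T)` is negative on every nonzero
vector of the linear space `N` of tangent vectors `(ξ, τ)` to `C^∞(ℝ/ℤ, M) × (0, ∞)` at `(x, T)`.
Its value at `(ξ, τ)` is the second derivative of `S_κ` along a curve through `(x, T)` with
velocity `(ξ, τ)`; at a critical point it does not depend on the curve. -/
structure IsNegativeFree (L : TangentBundle (𝓡 n) M → ℝ) (κ : ℝ) (x : ℝ → M) (T : ℝ)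
    (N : Submodule ℝ (((s : ℝ) → TangentSpace (𝓡 n) (x s)) × ℝ)) : Prop where
  tangent : ∀ v ∈ N, IsFieldAlong x v.1
  negative : ∀ v ∈ N, v ≠ 0 → ∀ (u : ℝ → ℝ → M) (θ : ℝ → ℝ),
    IsVariation n x u → IsPeriodVariation T θ → HasVariationField x u v.1 → deriv θ 0 = v.2 →
    iteratedDeriv 2 (fun r => action L κ (u r) (θ r)) 0 < 0

/-- The second differential at `x` of the fixed-period action functional `S_κ^T = S_κ(·, T)` on
`C^∞(ℝ/ℤ, M)` is negative on every nonzero vector of the linear space `N` of vector fields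
along `x`. -/
structure IsNegativeFixed (L : TangentBundle (𝓡 n) M → ℝ) (κ : ℝ) (x : ℝ → M) (T : ℝ)
    (N : Submodule ℝ ((s : ℝ) → TangentSpace (𝓡 n) (x s))) : Prop where
  tangent : ∀ ξ ∈ N, IsFieldAlong x ξ
  negative : ∀ ξ ∈ N, ξ ≠ 0 → ∀ u : ℝ → ℝ → M, IsVariation n x u → HasVariationField x u ξ →
    iteratedDeriv 2 (fun r => action L κ (u r) T) 0 < 0

/-- The free-period Morse index `i(x, T)`: the largest dimension of a linear space of tangent
vectors at `(x, T)` on which the second differential of `S_κ` is negative definite. -/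
def freeIndex (L : TangentBundle (𝓡 n) M → ℝ) (κ : ℝ) (x : ℝ → M) (T : ℝ) : ℕ∞ :=
  sSup {k : ℕ∞ | ∃ N : Submodule ℝ (((s : ℝ) → TangentSpace (𝓡 n) (x s)) × ℝ),
    IsNegativeFree L κ x T N ∧ FiniteDimensional ℝ N ∧ k = (Module.finrank ℝ N : ℕ∞)}

/-- The fixed-period Morse index `i_T(x)`: the largest dimension of a linear space of vector
fields along `x` on which the second differential of `S_κ^T` is negative definite. -/
def fixedIndex (L : TangentBundle (𝓡 n) M → ℝ) (κ : ℝ) (x : ℝ → M) (T : ℝ) : ℕ∞ :=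
  sSup {k : ℕ∞ | ∃ N : Submodule ℝ ((s : ℝ) → TangentSpace (𝓡 n) (x s)),
    IsNegativeFixed L κ x T N ∧ FiniteDimensional ℝ N ∧ k = (Module.finrank ℝ N : ℕ∞)}

/-! ### The Lagrangian flow and transversal non-degeneracy -/

/-- The Lagrangian read in the chart of `M` at `q₀`: its arguments are a point `q` of the chart's
image and a vector `v` in chart coordinates. -/
def chartLagrangian (L : TangentBundle (𝓡 n) M → ℝ) (q₀ : M) (q v : Model n) : ℝ :=
  L ⟨(chartAt (Model n) q₀).symm q,
    mfderiv 𝓘(ℝ, Model n) (𝓡 n) (chartAt (Model n) q₀).symm q v⟩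

/-- The curve `γ` solves the Euler-Lagrange equation `d/dt (∂L/∂v) = ∂L/∂q` at time `t`, written
in the chart at `γ t`. -/
def SolvesEulerLagrangeAt (L : TangentBundle (𝓡 n) M → ℝ) (γ : ℝ → M) (t : ℝ) : Prop :=
  let ℓ : Model n → Model n → ℝ := chartLagrangian L (γ t)
  let c : ℝ → Model n := fun s => chartAt (Model n) (γ t) (γ s)
  HasDerivAt (fun s => fderiv ℝ (fun v => ℓ (c s) v) (deriv c s))
    (fderiv ℝ (fun q => ℓ q (deriv c t)) (c t)) t

/-- `φ` is, near the point `p` of `TM`, the time-`T` map of the Lagrangian flow of `L`: for each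
`w` close to `p` there is a solution `γ` of the Euler-Lagrange equation on an open interval
containing `[0, T]` with `(γ, γ̇)(0) = w` and `(γ, γ̇)(T) = φ w`. -/
def IsTimeMapNear (L : TangentBundle (𝓡 n) M → ℝ) (T : ℝ)
    (φ : TangentBundle (𝓡 n) M → TangentBundle (𝓡 n) M) (p : TangentBundle (𝓡 n) M) : Prop :=
  ∀ᶠ w in 𝓝 p, ∃ (γ : ℝ → M) (δ : ℝ), 0 < δ ∧
    ContMDiffOn 𝓘(ℝ, ℝ) (𝓡 n) ∞ γ (Ioo (-δ) (T + δ)) ∧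
    (∀ t ∈ Ioo (-δ) (T + δ), SolvesEulerLagrangeAt L γ t) ∧
    velocity γ 0 = w ∧ velocity γ T = φ w

/-- The differential at `p` of a self-map `φ` of `TM`, as an endomorphism of `ℝⁿ × ℝⁿ`, the type
that underlies all the tangent spaces of `TM`. It is used when `φ p = p`. -/
def tangentEndo (φ : TangentBundle (𝓡 n) M → TangentBundle (𝓡 n) M)
    (p : TangentBundle (𝓡 n) M) : (Model n × Model n) →L[ℝ] (Model n × Model n) :=
  mfderiv (𝓡 n).tangent (𝓡 n).tangent φ p

/-- `(x, T)` is transversally non-degenerate: `1` is an eigenvalue of algebraic multiplicity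
exactly two of the differential, at `(γ(0), γ̇(0))` with `γ(t) = x(t/T)`, of the time-`T` map of
the Lagrangian flow. -/
def IsTransversallyNondegenerate (L : TangentBundle (𝓡 n) M → ℝ) (x : ℝ → M) (T : ℝ) : Prop :=
  ∃ φ : TangentBundle (𝓡 n) M → TangentBundle (𝓡 n) M,
    IsTimeMapNear L T φ (scaledVelocity T⁻¹ x 0) ∧
    φ (scaledVelocity T⁻¹ x 0) = scaledVelocity T⁻¹ x 0 ∧
    MDifferentiableAt (𝓡 n).tangent (𝓡 n).tangent φ (scaledVelocity T⁻¹ x 0) ∧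
    (LinearMap.charpoly (tangentEndo φ (scaledVelocity T⁻¹ x 0) :
      (Model n × Model n) →ₗ[ℝ] (Model n × Model n))).rootMultiplicity 1 = 2

/-- `(y κ, P κ)`, for `κ ∈ (κ₀ - ε, κ₀ + ε)`, is an orbit cylinder through `(x, T)`: a smooth family
of critical points of `S_κ`, which at `κ = κ₀` is `(x, T)`. So `t ↦ y κ (t / P κ)` is a closed
orbit of energy `κ` and period `P κ`. -/
structure IsOrbitCylinder (L : TangentBundle (𝓡 n) M → ℝ) (κ₀ : ℝ) (x : ℝ → M) (T : ℝ) (ε : ℝ)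
    (y : ℝ → ℝ → M) (P : ℝ → ℝ) : Prop where
  pos : 0 < ε
  smooth : ContMDiffOn 𝓘(ℝ, ℝ × ℝ) (𝓡 n) ∞ (fun p : ℝ × ℝ => y p.1 p.2)
    (Ioo (κ₀ - ε) (κ₀ + ε) ×ˢ univ)
  smooth_period : ContDiffOn ℝ ∞ P (Ioo (κ₀ - ε) (κ₀ + ε))
  critical : ∀ κ ∈ Ioo (κ₀ - ε) (κ₀ + ε), IsCriticalPoint L κ (y κ) (P κ)
  center : y κ₀ = x
  center_period : P κ₀ = T

end FreePeriod

end

/-! Let B be the second differential of the free-period action at `(x, T)`, let τ be the period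
component of a tangent vector, and let η be the velocity of the orbit cylinder, whose period
component is `T'(κ̄)`. The action depends on κ only through the summand κ times the period
(`action_add`). Differentiating the criticality of the cylinder in κ therefore gives `B(η, ·) = -τ`
(`IsOrbitCylinder.exists_velocity`). Hence ker τ, on which B is the fixed-period second
differential, is the B-orthogonal complement of η, and `B(η, η) = -T'(κ̄)`.

The rest is linear algebra (`negIndex_top_eq`). The index on the hyperplane ker τ is at most one
below the full index. If `T' > 0`, then η is a negative direction orthogonal to ker τ. If `T' = 0`,
then η is an isotropic vector of ker τ and spans a hyperbolic plane with any e such that `τ e = 1`;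
this plane supplies the extra negative direction. If `T' < 0`, then η is positive, and projecting
along η to ker τ can only lower B, so nothing is gained outside ker τ.

The analytic work is to make B a bilinear form on vector fields along `x`. No metric or connection
is used: loops vary in smooth families with finitely many parameters, modified in one chart of `M`
at a time. `IsFamily.exists_extension` realizes every smooth field as a velocity,
`IsCriticalPoint.iteratedDeriv_two_eq` shows that the second derivative sees only the velocity, and
`IsCriticalPoint.polarization_eq` identifies B with the Hessian of the action on a family, from
which bilinearity follows. -/

noncomputable section

namespace FreePeriod

/-! ### Parametric integrals and Hadamard quotients -/

section Calculus

variable {E F : Type} [NormedAddCommGroup E] [NormedSpace ℝ E] [NormedAddCommGroup F]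
  [NormedSpace ℝ F]

theorem continuousOn_slice_Icc {E F : Type*} [TopologicalSpace E] [TopologicalSpace F]
    {f : E × ℝ → F} {U : Set E} {W : Set (E × ℝ)}
    (hUW : U ×ˢ Icc (0 : ℝ) 1 ⊆ W) (hf : ContinuousOn f W) {p : E} (hp : p ∈ U) :
    ContinuousOn (fun s => f (p, s)) (Icc 0 1) :=
  hf.comp (by fun_prop) fun _ hs => hUW ⟨hp, hs⟩

/-- The derivative is bounded by `C` on the compact set `{p} × [0, 1]`, and the tube lemma carries
the bound `C + 1` to a neighbourhood of `p`; this is the required domination. The domain `W` need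
not be a product, so that integrands evaluated at scaled points are covered. -/
theorem hasFDerivAt_intervalIntegral {f : E × ℝ → F} {U : Set E} {W : Set (E × ℝ)}
    (hU : IsOpen U) (hW : IsOpen W) (hUW : U ×ˢ Icc (0 : ℝ) 1 ⊆ W) (hf : ContDiffOn ℝ 1 f W)
    {p : E} (hp : p ∈ U) :
    HasFDerivAt (fun p => ∫ s in (0 : ℝ)..1, f (p, s))
      (∫ s in (0 : ℝ)..1, (fderiv ℝ f (p, s)).comp (ContinuousLinearMap.inl ℝ E ℝ)) p := by
  have hcont : ContinuousOn (fun z => (fderiv ℝ f z).comp (ContinuousLinearMap.inl ℝ E ℝ)) W :=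
    (hf.continuousOn_fderiv_of_isOpen hW le_rfl).clm_comp continuousOn_const
  obtain ⟨C, hC⟩ := isCompact_Icc.exists_bound_of_continuousOn
    (continuousOn_slice_Icc hUW hcont hp)
  have hopen : IsOpen (W ∩ (fun z => ‖(fderiv ℝ f z).comp
      (ContinuousLinearMap.inl ℝ E ℝ)‖) ⁻¹' Iio (C + 1)) :=
    hcont.norm.isOpen_inter_preimage hW isOpen_Iio
  obtain ⟨u, v, hu, -, hpu, hv, huv⟩ := generalized_tube_lemma (isCompact_singleton (x := p))
    (isCompact_Icc (a := (0 : ℝ)) (b := 1)) hopen (by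
      rintro ⟨q, s⟩ ⟨rfl, hs⟩
      exact ⟨hUW ⟨hp, hs⟩, (hC s hs).trans_lt (lt_add_one C)⟩)
  have hsub : uIoc (0 : ℝ) 1 ⊆ Icc 0 1 := by
    rw [uIoc_of_le zero_le_one]; exact Ioc_subset_Icc_self
  have hmeas : ∀ {G : Type} [NormedAddCommGroup G] {g : ℝ → G}, ContinuousOn g (Icc 0 1) →
      MeasureTheory.AEStronglyMeasurable g (MeasureTheory.volume.restrict (uIoc (0 : ℝ) 1)) :=
    fun hg => (hg.mono hsub).aestronglyMeasurable measurableSet_uIoc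
  refine intervalIntegral.hasFDerivAt_integral_of_dominated_of_fderiv_le (𝕜 := ℝ)
    (bound := fun _ => C + 1) (F' := fun q s => (fderiv ℝ f (q, s)).comp (ContinuousLinearMap.inl ℝ E ℝ))
    (hu.mem_nhds (hpu rfl)) ?_ ?_ ?_ ?_ (by simp) ?_
  · filter_upwards [hU.mem_nhds hp] with q hq
    exact hmeas (continuousOn_slice_Icc hUW hf.continuousOn hq)
  · refine ContinuousOn.intervalIntegrable ?_
    rw [uIcc_of_le zero_le_one]
    exact continuousOn_slice_Icc hUW hf.continuousOn hp
  · exact hmeas (continuousOn_slice_Icc hUW hcont hp)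
  · refine Eventually.of_forall fun s hs q hq => ?_
    exact (huv (⟨hq, hv (hsub hs)⟩ : (q, s) ∈ u ×ˢ v)).2.le
  · refine Eventually.of_forall fun s hs q hq => ?_
    have h : (q, s) ∈ W := (huv (⟨hq, hv (hsub hs)⟩ : (q, s) ∈ u ×ˢ v)).1
    exact ((hf.contDiffAt (hW.mem_nhds h)).differentiableAt one_ne_zero).hasFDerivAt.comp q
      (hasFDerivAt_prodMk_left q s)

/-- The codomain is generalized in the induction because the derivative of the integral is the
integral of a map with values in `E →L[ℝ] F`. -/
theorem contDiffOn_nat_intervalIntegral (m : ℕ) {F : Type} [NormedAddCommGroup F]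
    [NormedSpace ℝ F] {f : E × ℝ → F} {U : Set E} {W : Set (E × ℝ)}
    (hU : IsOpen U) (hW : IsOpen W) (hUW : U ×ˢ Icc (0 : ℝ) 1 ⊆ W) (hf : ContDiffOn ℝ ∞ f W) :
    ContDiffOn ℝ m (fun p => ∫ s in (0 : ℝ)..1, f (p, s)) U := by
  induction m generalizing F with
  | zero =>
    rw [Nat.cast_zero, contDiffOn_zero]
    exact fun p hp => (hasFDerivAt_intervalIntegral hU hW hUW (hf.of_le (mod_cast le_top))
      hp).continuousAt.continuousWithinAt
  | succ m ih =>
    rw [Nat.cast_succ, contDiffOn_succ_iff_fderiv_of_isOpen hU]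
    have hd := fun p hp => hasFDerivAt_intervalIntegral hU hW hUW
      (hf.of_le (mod_cast le_top)) (p := p) hp
    refine ⟨fun p hp => (hd p hp).differentiableAt.differentiableWithinAt,
      fun h => absurd h (by simp), ?_⟩
    refine (ih (f := fun z => (fderiv ℝ f z).comp (ContinuousLinearMap.inl ℝ E ℝ)) ?_).congr
      fun p hp => (hd p hp).fderiv
    exact (hf.fderiv_of_isOpen hW (m := ∞) (by simp)).clm_comp contDiffOn_const

/-- An integral over `[0, 1]` depends smoothly on a parameter if the integrand is smooth. -/
theorem contDiffOn_intervalIntegral {f : E × ℝ → F} {U : Set E} {W : Set (E × ℝ)}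
    (hU : IsOpen U) (hW : IsOpen W) (hUW : U ×ˢ Icc (0 : ℝ) 1 ⊆ W) (hf : ContDiffOn ℝ ∞ f W) :
    ContDiffOn ℝ ∞ (fun p => ∫ s in (0 : ℝ)..1, f (p, s)) U :=
  contDiffOn_infty.2 fun m => contDiffOn_nat_intervalIntegral m hU hW hUW hf

/-- The quotient `(f(r, s) - f(0, s)) / r`, extended smoothly to `r = 0`. -/
def hadamardQuotient (f : ℝ × ℝ → F) (z : ℝ × ℝ) : F :=
  ∫ a in (0 : ℝ)..1, fderiv ℝ f (a * z.1, z.2) (1, 0)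

theorem mul_mem_Ioo {δ r a : ℝ} (hr : r ∈ Ioo (-δ) δ) (ha : a ∈ Icc (0 : ℝ) 1) :
    a * r ∈ Ioo (-δ) δ := by
  rw [mem_Ioo, ← abs_lt] at hr ⊢
  rw [abs_mul, abs_of_nonneg ha.1]
  exact (mul_le_of_le_one_left (abs_nonneg r) ha.2).trans_lt hr

theorem isOpen_strip (δ : ℝ) : IsOpen (Ioo (-δ) δ ×ˢ (univ : Set ℝ)) := isOpen_Ioo.prod isOpen_univ

theorem contDiffOn_hadamardQuotient {f : ℝ × ℝ → F} {δ : ℝ}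
    (hf : ContDiffOn ℝ ∞ f (Ioo (-δ) δ ×ˢ univ)) :
    ContDiffOn ℝ ∞ (hadamardQuotient f) (Ioo (-δ) δ ×ˢ univ) := by
  have hs : ContDiff ℝ ∞ fun z : (ℝ × ℝ) × ℝ => (z.2 * z.1.1, z.1.2) := by fun_prop
  refine contDiffOn_intervalIntegral (f := fun z => fderiv ℝ f (z.2 * z.1.1, z.1.2) (1, 0))
    (W := (fun z : (ℝ × ℝ) × ℝ => (z.2 * z.1.1, z.1.2)) ⁻¹' (Ioo (-δ) δ ×ˢ univ))
    (isOpen_strip δ) ((isOpen_strip δ).preimage hs.continuous) ?_ ?_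
  · rintro ⟨⟨r, s⟩, a⟩ ⟨⟨hr, -⟩, ha⟩
    exact ⟨mul_mem_Ioo hr ha, mem_univ _⟩
  · exact ((hf.fderiv_of_isOpen (isOpen_strip δ) (m := ∞) (by simp)).comp hs.contDiffOn
      fun z hz => hz).clm_apply contDiffOn_const

theorem hasDerivAt_slice {f : ℝ × ℝ → F} {r s : ℝ} (hf : DifferentiableAt ℝ f (r, s)) :
    HasDerivAt (fun r => f (r, s)) (fderiv ℝ f (r, s) (1, 0)) r := by
  simpa [Function.comp_def] using (hf.hasFDerivAt.comp r (hasFDerivAt_prodMk_left r s)).hasDerivAt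

/-- The fundamental theorem of calculus along `a ↦ f (a * r, s)`. -/
theorem smul_hadamardQuotient [CompleteSpace F] {f : ℝ × ℝ → F} {δ r s : ℝ}
    (hf : ContDiffOn ℝ ∞ f (Ioo (-δ) δ ×ˢ univ)) (hr : r ∈ Ioo (-δ) δ) (h0 : f (0, s) = 0) :
    r • hadamardQuotient f (r, s) = f (r, s) := by
  have hd : ∀ a ∈ uIcc (0 : ℝ) 1, HasDerivAt (fun a => f (a * r, s))
      (r • fderiv ℝ f (a * r, s) (1, 0)) a := by
    intro a ha
    rw [uIcc_of_le zero_le_one] at ha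
    have h1 := hasDerivAt_slice (s := s) ((hf.contDiffAt ((isOpen_strip δ).mem_nhds
      ⟨mul_mem_Ioo hr ha, mem_univ s⟩)).differentiableAt (by simp))
    exact h1.scomp a (hasDerivAt_mul_const r)
  have hc : ContinuousOn (fun a : ℝ => r • fderiv ℝ f (a * r, s) (1, 0)) (uIcc 0 1) := by
    rw [uIcc_of_le zero_le_one]
    refine continuousOn_const.smul (ContinuousOn.clm_apply ?_ continuousOn_const)
    exact (hf.continuousOn_fderiv_of_isOpen (isOpen_strip δ) (by simp)).comp
      (by fun_prop) fun a ha => ⟨mul_mem_Ioo hr ha, mem_univ s⟩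
  have := intervalIntegral.integral_eq_sub_of_hasDerivAt hd hc.intervalIntegrable
  rw [intervalIntegral.integral_smul] at this
  simpa [hadamardQuotient, h0] using this

theorem hadamardQuotient_zero (f : ℝ × ℝ → F) [CompleteSpace F] (s : ℝ) :
    hadamardQuotient f (0, s) = fderiv ℝ f (0, s) (1, 0) := by
  simp [hadamardQuotient]

/-- A smooth function that vanishes to second order at `r = 0` is `r²` times a smooth function. -/
theorem exists_sq_smul_eq [CompleteSpace F] {f : ℝ × ℝ → F} {δ : ℝ} (hδ : 0 < δ)
    (hf : ContDiffOn ℝ ∞ f (Ioo (-δ) δ ×ˢ univ)) (h0 : ∀ s, f (0, s) = 0)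
    (h1 : ∀ s, deriv (fun r => f (r, s)) 0 = 0)
    (hper : ∀ r ∈ Ioo (-δ) δ, ∀ s, f (r, s + 1) = f (r, s))
    {A : Set ℝ} (hA : IsClosed A) (hfA : ∀ r ∈ Ioo (-δ) δ, ∀ s ∉ A, f (r, s) = 0) :
    ∃ D : ℝ → ℝ → F, ContDiffOn ℝ ∞ (fun z : ℝ × ℝ => D z.1 z.2) (Ioo (-δ) δ ×ˢ univ) ∧
      (∀ r ∈ Ioo (-δ) δ, ∀ s, r ^ 2 • D r s = f (r, s)) ∧
      (∀ r ∈ Ioo (-δ) δ, ∀ s, D r (s + 1) = D r s) ∧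
      (∀ r ∈ Ioo (-δ) δ, ∀ s ∉ A, D r s = 0) := by
  -- The quotient at `(r, s)` sees only the germs of `g` along the segment from `(0, s)` to `(r,
  -- s)`, so it inherits periodicity and, in `hvan`, vanishing off `A`.
  have hsub : ∀ g : ℝ × ℝ → F, ∀ t : ℝ, (∀ r ∈ Ioo (-δ) δ, ∀ s, g (r, s + t) = g (r, s)) →
      ∀ r ∈ Ioo (-δ) δ, ∀ s, hadamardQuotient g (r, s + t) = hadamardQuotient g (r, s) := by
    intro g t hg r hr s
    refine intervalIntegral.integral_congr fun a ha => ?_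
    rw [uIcc_of_le zero_le_one] at ha
    have he : (fun z : ℝ × ℝ => g (z + (0, t))) =ᶠ[𝓝 (a * r, s)] g := by
      filter_upwards [(isOpen_strip δ).mem_nhds ⟨mul_mem_Ioo hr ha, mem_univ s⟩] with z hz
      have := hg z.1 hz.1 z.2
      rwa [show (z.1, z.2 + t) = z + (0, t) by ext <;> simp] at this
    have := he.fderiv_eq (𝕜 := ℝ)
    rw [fderiv_comp_add_right] at this
    simp only [Prod.mk_add_mk, add_zero] at this
    simp [this]
  have hvan : ∀ g : ℝ × ℝ → F, (∀ r ∈ Ioo (-δ) δ, ∀ s ∉ A, g (r, s) = 0) →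
      ∀ r ∈ Ioo (-δ) δ, ∀ s ∉ A, hadamardQuotient g (r, s) = 0 := by
    intro g hg r hr s hs
    rw [hadamardQuotient, ← intervalIntegral.integral_zero (a := 0) (b := 1) (E := F)]
    refine intervalIntegral.integral_congr fun a ha => ?_
    rw [uIcc_of_le zero_le_one] at ha
    have he : g =ᶠ[𝓝 (a * r, s)] fun _ => 0 := by
      filter_upwards [(isOpen_Ioo.prod hA.isOpen_compl).mem_nhds ⟨mul_mem_Ioo hr ha, hs⟩]
        with z hz using hg z.1 hz.1 z.2 hz.2
    simp [he.fderiv_eq (𝕜 := ℝ)]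
  have h00 : (0 : ℝ) ∈ Ioo (-δ) δ := by simp [hδ]
  -- At `r = 0` the first quotient is the `r`-derivative of `f`, which is zero; hence a second
  -- division by `r` is possible.
  have hg0 : ∀ s, hadamardQuotient f (0, s) = 0 := fun s => by
    rw [hadamardQuotient_zero, ← h1 s]
    exact (hasDerivAt_slice ((hf.contDiffAt ((isOpen_strip δ).mem_nhds
      ⟨h00, mem_univ s⟩)).differentiableAt (by simp))).deriv.symm
  have hg := contDiffOn_hadamardQuotient hf
  refine ⟨fun r s => hadamardQuotient (hadamardQuotient f) (r, s),
    contDiffOn_hadamardQuotient hg, fun r hr s => ?_, hsub _ 1 (hsub f 1 hper), hvan _ (hvan f hfA)⟩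
  rw [pow_two, mul_smul, smul_hadamardQuotient hg hr (hg0 s), smul_hadamardQuotient hf hr (h0 s)]

end Calculus

/-! ### Periodic bump functions and tubes around `{0} × ℝ/ℤ` -/

/-- A smooth step composed with `cos (2π(s - c))` is periodic for free. The step rises from 0 at the
level `1 - 4e²` to 1 at `1 - 2e²`. The closed set `A` contains the support of `ρ`: loops are later
modified by a chart formula on `A` and left alone off `A`. -/
theorem exists_periodic_bump {O : Set ℝ} (hper : ∀ s, s + 1 ∈ O ↔ s ∈ O) {c : ℝ} (hO : O ∈ 𝓝 c) :
    ∃ (ρ : ℝ → ℝ) (A : Set ℝ), ContDiff ℝ ∞ ρ ∧ (∀ s, ρ (s + 1) = ρ s) ∧ IsClosed A ∧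
      (∀ s, s + 1 ∈ A ↔ s ∈ A) ∧ A ⊆ O ∧ (∀ s ∉ A, ρ s = 0) ∧ ∀ᶠ s in 𝓝 c, ρ s = 1 := by
  obtain ⟨e, he, hball⟩ := Metric.mem_nhds_iff.1 hO
  set f : ℝ → ℝ := fun s => Real.cos (2 * Real.pi * (s - c)) with hf
  have hfper : ∀ s, f (s + 1) = f s := fun s => by
    simp only [hf]
    rw [show 2 * Real.pi * (s + 1 - c) = 2 * Real.pi * (s - c) + 2 * Real.pi by ring,
      Real.cos_add_two_pi]
  have hfc : ContDiff ℝ ∞ f := by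
    simp only [hf]; exact Real.contDiff_cos.comp (by fun_prop)
  have hOint : ∀ (k : ℤ) (s : ℝ), s + k ∈ O ↔ s ∈ O := by
    have : Function.Periodic (fun s => s ∈ O) 1 := fun s => propext (hper s)
    intro k s
    simpa using iff_of_eq (this.int_mul k s)
  refine ⟨fun s => Real.smoothTransition ((f s - (1 - 4 * e ^ 2)) / (2 * e ^ 2)),
    {s | 1 - 4 * e ^ 2 ≤ f s}, ?_, fun s => by simp only [hfper], ?_, fun s => by simp [hfper], ?_, ?_, ?_⟩
  · exact Real.smoothTransition.contDiff.comp (by fun_prop)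
  · exact isClosed_le continuous_const hfc.continuous
  · intro s hs
    set k := round (s - c)
    have hk : |s - c - k| ≤ 1 / 2 := abs_sub_round _
    have h1 : f s = Real.cos (2 * Real.pi * (s - c - k)) := by
      simp only [hf]
      rw [show 2 * Real.pi * (s - c - k) = 2 * Real.pi * (s - c) - k * (2 * Real.pi) by ring,
        Real.cos_sub_int_mul_two_pi]
    -- This is `cos y ≤ 1 - 2y²/π²` for `|y| ≤ π`, at `y = 2π(s - c - k)`. With `f s ≥ 1 - 4e²` it
    -- puts `s` within `e` of `c + k`.
    have h2 : Real.cos (2 * Real.pi * (s - c - k)) ≤ 1 - 8 * (s - c - k) ^ 2 := by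
      refine (Real.cos_le_one_sub_mul_cos_sq ?_).trans_eq ?_
      · rw [abs_mul, abs_of_pos Real.two_pi_pos]
        nlinarith [Real.pi_pos]
      · field_simp
        ring
    have h3 : (s - c - k) ^ 2 < e ^ 2 := by
      have := mem_ofPred_eq ▸ hs
      rw [h1] at this
      nlinarith [sq_pos_of_pos he]
    rw [← hOint (-k) s]
    refine hball ?_
    rw [Metric.mem_ball, Real.dist_eq]
    have := abs_lt_of_sq_lt_sq h3 he.le
    rwa [Int.cast_neg, show s + -(k : ℝ) - c = s - c - k by ring]
  · intro s hs
    refine Real.smoothTransition.zero_of_nonpos ?_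
    have : f s < 1 - 4 * e ^ 2 := not_le.1 hs
    exact div_nonpos_of_nonpos_of_nonneg (by linarith) (by positivity)
  · have : ∀ᶠ s in 𝓝 c, 1 - 2 * e ^ 2 < f s :=
      hfc.continuous.continuousAt.eventually_const_lt (by simp [hf]; positivity)
    filter_upwards [this] with s hs
    refine Real.smoothTransition.one_of_one_le ?_
    rw [le_div_iff₀ (by positivity)]
    linarith

theorem exists_mem_Icc_of_periodic (s : ℝ) : ∃ (k : ℤ) (t : ℝ), t ∈ Icc (0 : ℝ) 1 ∧ s = t + k :=
  ⟨⌊s⌋, Int.fract s, ⟨Int.fract_nonneg s, (Int.fract_lt_one s).le⟩, (Int.fract_add_floor s).symm⟩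

/-- The set `A` is not compact, but `A ∩ [0, 1]` is; the tube lemma applies there, and periodicity
of `A` and `O` carries the inclusion to all times. -/
theorem exists_tube {P : Type*} [TopologicalSpace P] {p₀ : P} {U : Set P} (hU : IsOpen U)
    (hp₀ : p₀ ∈ U) {A : Set ℝ} (hA : IsClosed A) (hAper : ∀ s, s + 1 ∈ A ↔ s ∈ A) {O : Set (P × ℝ)}
    (hO : ∀ s ∈ A, O ∈ 𝓝 (p₀, s)) (hOper : ∀ p ∈ U, ∀ s, (p, s + 1) ∈ O ↔ (p, s) ∈ O) :
    ∃ V ⊆ U, IsOpen V ∧ p₀ ∈ V ∧ V ×ˢ A ⊆ O := by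
  obtain ⟨u, v, hu, -, hpu, hv, huv⟩ := generalized_tube_lemma (isCompact_singleton (x := p₀))
    (isCompact_Icc.inter_right hA : IsCompact (Icc (0 : ℝ) 1 ∩ A)) (isOpen_interior (s := O)) (by
      rintro ⟨q, s⟩ ⟨rfl, hs⟩
      exact mem_interior_iff_mem_nhds.2 (hO s hs.2))
  refine ⟨u ∩ U, inter_subset_right, hu.inter hU, ⟨hpu rfl, hp₀⟩, ?_⟩
  rintro ⟨p, s⟩ ⟨⟨hpu, hpU⟩, hs⟩
  obtain ⟨k, t, ht, rfl⟩ := exists_mem_Icc_of_periodic s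
  have h1 : Function.Periodic (fun s => s ∈ A) 1 := fun s => propext (hAper s)
  have h2 : Function.Periodic (fun s => (p, s) ∈ O) 1 := fun s => propext (hOper p hpU s)
  have h1k := iff_of_eq (h1.int_mul k t)
  have h2k := iff_of_eq (h2.int_mul k t)
  simp only [mul_one] at h1k h2k
  exact h2k.2 (interior_subset (huv ⟨hpu, hv ⟨ht, h1k.1 hs⟩⟩))

/-! ### Velocities and tangent vectors in charts -/

section Tangent

variable {n : ℕ} {M : Type*} [TopologicalSpace M] [ChartedSpace (Model n) M]
  {E G : Type} [NormedAddCommGroup E] [NormedSpace ℝ E] [NormedAddCommGroup G] [NormedSpace ℝ G]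

theorem tangent_mk_eq_iff {p q : M} {v w : Model n} :
    (⟨p, v⟩ : TangentBundle (𝓡 n) M) = ⟨q, w⟩ ↔ p = q ∧ v = w := by
  constructor
  · intro h
    have := (Bundle.TotalSpace.mk.injEq _ _ _ _).mp h
    exact ⟨this.1, eq_of_heq this.2⟩
  · rintro ⟨rfl, rfl⟩; rfl

theorem velocity_congr {a b : ℝ → M} {t : ℝ} (h : a =ᶠ[𝓝 t] b) :
    (velocity a t : TangentBundle (𝓡 n) M) = velocity b t :=
  tangent_mk_eq_iff.2 ⟨h.eq_of_nhds, DFunLike.congr_fun h.mfderiv_eq (1 : ℝ)⟩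

theorem velocity_comp {f : E → M} {c : ℝ → E} {c' : E} {t : ℝ}
    (hf : MDifferentiableAt 𝓘(ℝ, E) (𝓡 n) f (c t)) (hc : HasDerivAt c c' t) :
    velocity (fun r => f (c r)) t = tangentMap 𝓘(ℝ, E) (𝓡 n) f ⟨c t, c'⟩ := by
  refine tangent_mk_eq_iff.2 ⟨rfl, ?_⟩
  have h := mfderiv_comp t hf hc.differentiableAt.mdifferentiableAt
  have h2 := DFunLike.congr_fun h (1 : ℝ)
  refine h2.trans ?_
  have h3 : (mfderiv 𝓘(ℝ, ℝ) 𝓘(ℝ, E) c t (1 : ℝ) : E) = c' := by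
    rw [mfderiv_eq_fderiv]
    exact hc.deriv
  exact congrArg (mfderiv 𝓘(ℝ, E) (𝓡 n) f (c t)) h3

theorem contMDiffOn_tangent_mk {c c' : G → E} {V : Set G} (hc : ContDiffOn ℝ ∞ c V)
    (hc' : ContDiffOn ℝ ∞ c' V) :
    ContMDiffOn 𝓘(ℝ, G) 𝓘(ℝ, E).tangent ∞
      (fun g => (⟨c g, c' g⟩ : TangentBundle 𝓘(ℝ, E) E)) V := by
  intro g hg
  refine Bundle.contMDiffWithinAt_totalSpace.2 ⟨(hc g hg).contMDiffWithinAt, ?_⟩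
  convert! (hc' g hg).contMDiffWithinAt with y
  simp

variable [IsManifold (𝓡 n) ∞ M]

theorem contMDiffOn_tangentMap {f : E → M} {O : Set E} (hO : IsOpen O)
    (hf : ContMDiffOn 𝓘(ℝ, E) (𝓡 n) ∞ f O) {c c' : G → E} {V : Set G} (hc : ContDiffOn ℝ ∞ c V)
    (hc' : ContDiffOn ℝ ∞ c' V) (hV : MapsTo c V O) :
    ContMDiffOn 𝓘(ℝ, G) (𝓡 n).tangent ∞
      (fun g => tangentMap 𝓘(ℝ, E) (𝓡 n) f ⟨c g, c' g⟩) V := by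
  have : IsManifold (𝓡 n) 1 M := .of_le (n := ∞) (mod_cast le_top)
  have h := hf.contMDiffOn_tangentMapWithin (m := ∞) (by simp) hO.uniqueMDiffOn
  refine (h.comp (contMDiffOn_tangent_mk hc hc') fun g hg => hV hg).congr fun g hg => ?_
  rw [Function.comp_apply, tangentMapWithin_eq_tangentMap (hO.uniqueMDiffOn _ (hV hg))]
  exact (hf.mdifferentiableOn (by simp) _ (hV hg)).mdifferentiableAt (hO.mem_nhds (hV hg))

/-- The coordinates of a tangent vector in the chart at `q`. -/
def chartVec (q : M) (v : TangentBundle (𝓡 n) M) : Model n :=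
  mfderiv (𝓡 n) 𝓘(ℝ, Model n) (chartAt (Model n) q) v.1 v.2

theorem chartVec_velocity {q : M} {a : ℝ → M} {t : ℝ}
    (ha : MDifferentiableAt 𝓘(ℝ, ℝ) (𝓡 n) a t) (hq : a t ∈ (chartAt (Model n) q).source) :
    chartVec q (velocity a t) = deriv (fun r => chartAt (Model n) q (a r)) t := by
  have : IsManifold (𝓡 n) 1 M := .of_le (n := ∞) (mod_cast le_top)
  have h := mfderiv_comp t (mdifferentiableAt_atlas (I := 𝓡 n) (chart_mem_atlas _ q) hq) ha
  have h2 := DFunLike.congr_fun h (1 : ℝ)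
  rw [mfderiv_eq_fderiv] at h2
  exact h2.symm

theorem chartVec_injective {q p : M} (hp : p ∈ (chartAt (Model n) q).source) {v w : Model n}
    (h : chartVec q (⟨p, v⟩ : TangentBundle (𝓡 n) M) = chartVec q ⟨p, w⟩) : v = w := by
  have : IsManifold (𝓡 n) 1 M := .of_le (n := ∞) (mod_cast le_top)
  exact (mdifferentiable_chart (I := 𝓡 n) q).mfderiv_injective hp h

theorem eq_of_chartVec_eq {q : M} {v w : TangentBundle (𝓡 n) M} (hvw : v.1 = w.1)
    (hv : v.1 ∈ (chartAt (Model n) q).source) (h : chartVec q v = chartVec q w) : v = w := by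
  obtain ⟨p, v⟩ := v
  obtain ⟨p', w⟩ := w
  obtain rfl : p = p' := hvw
  exact tangent_mk_eq_iff.2 ⟨rfl, chartVec_injective hv h⟩

theorem contMDiffOn_chartVec (q : M) : ContMDiffOn (𝓡 n).tangent 𝓘(ℝ, Model n) ∞
    (chartVec q : TangentBundle (𝓡 n) M → Model n)
    {v | v.1 ∈ (chartAt (Model n) q).source} := by
  have : IsManifold (𝓡 n) 1 M := .of_le (n := ∞) (mod_cast le_top)
  have hO := (chartAt (Model n) q).open_source
  have hf : ContMDiffOn (𝓡 n) 𝓘(ℝ, Model n) ∞ (chartAt (Model n) q) _ := contMDiffOn_chart (x := q)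
  have h := hf.contMDiffOn_tangentMapWithin (m := ∞) (by simp) hO.uniqueMDiffOn
  refine ((contMDiff_snd_tangentBundle_modelSpace (Model n) 𝓘(ℝ, Model n)).comp_contMDiffOn
    h).congr fun v hv => ?_
  have e := tangentMapWithin_eq_tangentMap (hO.uniqueMDiffOn _ hv)
    (mdifferentiableAt_atlas (I := 𝓡 n) (chart_mem_atlas _ q) hv)
  change _ = (tangentMapWithin (𝓡 n) 𝓘(ℝ, Model n) (chartAt (Model n) q) _ v).2
  rw [e]
  rfl

end Tangent

/-! ### Smooth families of loops -/

section ChartPush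

variable {n : ℕ} {M : Type*} [TopologicalSpace M] [ChartedSpace (Model n) M] {P : Type}
  {w : P → ℝ → M}

/-- The family `w`, modified for the times in `A` by adding `D` in the chart at `q`. -/
def chartPush (q : M) (A : Set ℝ) (w : P → ℝ → M) (D : P → ℝ → Model n) (p : P) (s : ℝ) : M :=
  open Classical in
  if s ∈ A then (chartAt (Model n) q).symm (chartAt (Model n) q (w p s) + D p s) else w p s

theorem chartPush_of_mem {q : M} {A : Set ℝ} {D : P → ℝ → Model n} {p : P} {s : ℝ} (hs : s ∈ A) :
    chartPush q A w D p s =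
      (chartAt (Model n) q).symm (chartAt (Model n) q (w p s) + D p s) :=
  if_pos hs

theorem chartPush_of_notMem {q : M} {A : Set ℝ} {D : P → ℝ → Model n} {p : P} {s : ℝ}
    (hs : s ∉ A) : chartPush q A w D p s = w p s :=
  if_neg hs

end ChartPush

section Family

variable {n : ℕ} {M : Type*} [TopologicalSpace M] [ChartedSpace (Model n) M]
  {P Q : Type} [NormedAddCommGroup P] [NormedSpace ℝ P] [NormedAddCommGroup Q] [NormedSpace ℝ Q]

variable (n) in
/-- `w` is a smooth family of loops in `M`, parametrized by a neighbourhood `U` of `0` in a normed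
space. -/
structure IsFamily (U : Set P) (w : P → ℝ → M) : Prop where
  isOpen : IsOpen U
  zero_mem : 0 ∈ U
  periodic : ∀ p ∈ U, Function.Periodic (w p) 1
  smooth : ContMDiffOn 𝓘(ℝ, P × ℝ) (𝓡 n) ∞ (fun z : P × ℝ => w z.1 z.2) (U ×ˢ univ)

variable {U : Set P} {w : P → ℝ → M}

theorem IsVariation.exists_isFamily {x : ℝ → M} {u : ℝ → ℝ → M} (hu : IsVariation n x u) :
    ∃ δ > 0, IsFamily n (Ioo (-δ) δ) u := by
  obtain ⟨δ, hδ, hper, hs⟩ := hu.smooth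
  exact ⟨δ, hδ, isOpen_Ioo, by simp [hδ], hper, hs⟩

theorem exists_Ioo_subset {V : Set ℝ} (hV : V ∈ 𝓝 (0 : ℝ)) : ∃ δ > 0, Ioo (-δ) δ ⊆ V := by
  obtain ⟨δ, hδ, h⟩ := Metric.mem_nhds_iff.1 hV
  rw [Real.ball_eq_Ioo, zero_sub, zero_add] at h
  exact ⟨δ, hδ, h⟩

theorem IsFamily.comp (hw : IsFamily n U w) {V : Set Q} {h : Q → P} (hV : IsOpen V) (h0 : 0 ∈ V)
    (hh : ContDiffOn ℝ ∞ h V) (hm : MapsTo h V U) : IsFamily n V (fun p => w (h p)) where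
  isOpen := hV
  zero_mem := h0
  periodic p hp := hw.periodic _ (hm hp)
  smooth := by
    have h2 : ContDiffOn ℝ ∞ (fun z : Q × ℝ => (h z.1, z.2)) (V ×ˢ univ) :=
      (hh.comp contDiffOn_fst fun z hz => hz.1).prodMk contDiffOn_snd
    exact hw.smooth.comp h2.contMDiffOn fun z hz => ⟨hm hz.1, mem_univ _⟩

theorem IsFamily.mono (hw : IsFamily n U w) {V : Set P} (hV : IsOpen V) (h0 : 0 ∈ V) (h : V ⊆ U) :
    IsFamily n V w :=
  hw.comp hV h0 contDiffOn_id h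

theorem IsFamily.isVariation {u : ℝ → ℝ → M} {V : Set ℝ} (hu : IsFamily n V u) :
    IsVariation n (u 0) u := by
  obtain ⟨δ, hδ, h⟩ := exists_Ioo_subset (hu.isOpen.mem_nhds hu.zero_mem)
  exact ⟨rfl, δ, hδ, fun r hr => hu.periodic r (h hr), hu.smooth.mono (prod_mono_left h)⟩

theorem IsFamily.isOpen_prod (hw : IsFamily n U w) : IsOpen (U ×ˢ (univ : Set ℝ)) :=
  hw.isOpen.prod isOpen_univ

theorem IsFamily.mdifferentiableAt (hw : IsFamily n U w) {p : P} (hp : p ∈ U) (s : ℝ) :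
    MDifferentiableAt 𝓘(ℝ, P × ℝ) (𝓡 n) (fun z : P × ℝ => w z.1 z.2) (p, s) :=
  (hw.smooth.contMDiffAt (hw.isOpen_prod.mem_nhds ⟨hp, mem_univ s⟩)).mdifferentiableAt (by simp)

theorem IsFamily.velocity_comp (hw : IsFamily n U w) {c : ℝ → P} {c' : P} {t : ℝ}
    (hc : HasDerivAt c c' t) (ht : c t ∈ U) (s : ℝ) :
    velocity (fun r => w (c r) s) t =
      tangentMap 𝓘(ℝ, P × ℝ) (𝓡 n) (fun z : P × ℝ => w z.1 z.2) ⟨(c t, s), (c', 0)⟩ :=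
  FreePeriod.velocity_comp (f := fun z : P × ℝ => w z.1 z.2) (c := fun r => (c r, s))
    (hw.mdifferentiableAt ht s) (hc.prodMk (hasDerivAt_const t s))

theorem IsFamily.velocity_smul (hw : IsFamily n U w) (a : P) (s : ℝ) :
    velocity (fun r : ℝ => w (r • a) s) 0 =
      tangentMap 𝓘(ℝ, P × ℝ) (𝓡 n) (fun z : P × ℝ => w z.1 z.2) ⟨(0, s), (a, 0)⟩ := by
  have hc : HasDerivAt (fun r : ℝ => r • a) a 0 := by
    simpa using (hasDerivAt_id (0 : ℝ)).smul_const a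
  have h := hw.velocity_comp hc (by simpa using hw.zero_mem) s
  exact h.trans (congrArg (fun p => tangentMap 𝓘(ℝ, P × ℝ) (𝓡 n)
    (fun z : P × ℝ => w z.1 z.2) ⟨(p, s), (a, 0)⟩) (zero_smul ℝ a))

/-- Reparametrizing a family by a curve leaves only the first-order part of the curve in the
velocity, so higher-order corrections such as `r ↦ (r, r²)` are invisible. -/
theorem IsFamily.velocity_eq_smul (hw : IsFamily n U w) {c : ℝ → P} {c' : P}
    (hc : HasDerivAt c c' 0) (h0 : c 0 = 0) (s : ℝ) :
    (velocity (fun r => w (c r) s) 0 : TangentBundle (𝓡 n) M) =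
      velocity (fun r : ℝ => w (r • c') s) 0 := by
  rw [hw.velocity_comp hc (by rw [h0]; exact hw.zero_mem), hw.velocity_smul, h0]

theorem IsFamily.scaledVelocity_eq (hw : IsFamily n U w) {p : P} (hp : p ∈ U) (a s : ℝ) :
    scaledVelocity a (w p) s =
      tangentMap 𝓘(ℝ, P × ℝ) (𝓡 n) (fun z : P × ℝ => w z.1 z.2) ⟨(p, s), (0, a)⟩ := by
  have h := FreePeriod.velocity_comp (f := fun z : P × ℝ => w z.1 z.2) (c := fun r => (p, r))
    (c' := (0, 1)) (t := s) (hw.mdifferentiableAt hp s)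
    ((hasDerivAt_const s p).prodMk (hasDerivAt_id s))
  have h2 := (tangent_mk_eq_iff.1 h).2
  refine tangent_mk_eq_iff.2 ⟨rfl, ?_⟩
  refine (congrArg (fun v : Model n => a • v) h2).trans ?_
  have h3 := map_smul (mfderiv 𝓘(ℝ, P × ℝ) (𝓡 n) (fun z : P × ℝ => w z.1 z.2) (p, s)) a
    ((0, 1) : P × ℝ)
  refine h3.symm.trans (congrArg (mfderiv 𝓘(ℝ, P × ℝ) (𝓡 n)
    (fun z : P × ℝ => w z.1 z.2) (p, s)) ?_)
  change (a • (0 : P), a • (1 : ℝ)) = (0, a)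
  simp

theorem IsFamily.periodic_velocity (hw : IsFamily n U w) (a : P) :
    Function.Periodic (fun s => (velocity (fun r : ℝ => w (r • a) s) 0 : TangentBundle (𝓡 n) M))
      1 := by
  intro s
  refine velocity_congr ?_
  have : ∀ᶠ r : ℝ in 𝓝 0, r • a ∈ U :=
    (by fun_prop : Continuous fun r : ℝ => r • a).continuousAt.eventually_mem
      (hw.isOpen.mem_nhds (by simpa using hw.zero_mem))
  filter_upwards [this] with r hr using hw.periodic _ hr s

variable [IsManifold (𝓡 n) ∞ M]

theorem IsFamily.contMDiff_velocity (hw : IsFamily n U w) (a : P) :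
    ContMDiff 𝓘(ℝ, ℝ) (𝓡 n).tangent ∞
      (fun s => (velocity (fun r : ℝ => w (r • a) s) 0 : TangentBundle (𝓡 n) M)) := by
  rw [← contMDiffOn_univ]
  refine (contMDiffOn_tangentMap hw.isOpen_prod hw.smooth (c := fun s : ℝ => (0, s))
    (c' := fun _ => (a, 0)) (V := univ) (by fun_prop) (by fun_prop)
    fun s _ => ⟨hw.zero_mem, mem_univ _⟩).congr fun s _ => hw.velocity_smul a s

theorem IsFamily.differentiableAt_chart (hw : IsFamily n U w) {q : M} {s : ℝ}
    (hs : w 0 s ∈ (chartAt (Model n) q).source) :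
    DifferentiableAt ℝ (fun p => chartAt (Model n) q (w p s)) 0 := by
  have : IsManifold (𝓡 n) 1 M := .of_le (n := ∞) (mod_cast le_top)
  have h1 := (hw.mdifferentiableAt hw.zero_mem s).comp (I := 𝓘(ℝ, P)) (0 : P)
    (differentiableAt_id.prodMk (differentiableAt_const s)).mdifferentiableAt
  exact ((mdifferentiableAt_atlas (I := 𝓡 n) (chart_mem_atlas _ q) hs).comp (0 : P)
    h1).differentiableAt

theorem IsFamily.chartVec_velocity (hw : IsFamily n U w) {q : M} {s : ℝ}
    (hs : w 0 s ∈ (chartAt (Model n) q).source) (a : P) :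
    chartVec q (velocity (fun r : ℝ => w (r • a) s) 0 : TangentBundle (𝓡 n) M) =
      fderiv ℝ (fun p => chartAt (Model n) q (w p s)) 0 a := by
  have hc : HasDerivAt (fun r : ℝ => r • a) a 0 := by
    simpa using (hasDerivAt_id (0 : ℝ)).smul_const a
  have hd : HasFDerivAt (fun p => chartAt (Model n) q (w p s))
      (fderiv ℝ (fun p => chartAt (Model n) q (w p s)) 0) ((0 : ℝ) • a) := by
    rw [zero_smul]; exact (hw.differentiableAt_chart hs).hasFDerivAt
  have hm : MDifferentiableAt 𝓘(ℝ, ℝ) (𝓡 n) (fun r : ℝ => w (r • a) s) 0 := by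
    refine MDifferentiableAt.comp (I' := 𝓘(ℝ, P × ℝ)) (g := fun z : P × ℝ => w z.1 z.2)
      (f := fun r : ℝ => (r • a, s)) 0 ?_
      (hc.differentiableAt.prodMk (differentiableAt_const s)).mdifferentiableAt
    rw [zero_smul]
    exact hw.mdifferentiableAt hw.zero_mem s
  rw [FreePeriod.chartVec_velocity hm (by simpa using hs)]
  exact (hd.comp_hasDerivAt 0 hc).deriv

/-- The chart formula and `w` agree wherever `D` vanishes, in particular off `A`, so the two
branches glue smoothly across the boundary of `A`. Shrinking `U` to `V` by `exists_tube` keeps the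
pushed points in the chart target for all times in `A` at once. -/
theorem IsFamily.exists_chartPush (hw : IsFamily n U w) {q : M} {A : Set ℝ} (hA : IsClosed A)
    (hAper : ∀ s, s + 1 ∈ A ↔ s ∈ A) (hsrc : ∀ s ∈ A, w 0 s ∈ (chartAt (Model n) q).source)
    {D : P → ℝ → Model n} (hD : ContDiffOn ℝ ∞ (fun z : P × ℝ => D z.1 z.2) (U ×ˢ univ))
    (hDper : ∀ p ∈ U, ∀ s, D p (s + 1) = D p s) (hD0 : ∀ s, D 0 s = 0)
    (hDA : ∀ p ∈ U, ∀ s ∉ A, D p s = 0) :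
    ∃ V ⊆ U, IsFamily n V (chartPush q A w D) ∧ ∀ p ∈ V, ∀ s ∈ A,
      w p s ∈ (chartAt (Model n) q).source ∧
        chartAt (Model n) q (w p s) + D p s ∈ (chartAt (Model n) q).target := by
  set φ := chartAt (Model n) q
  set O₁ : Set (P × ℝ) := U ×ˢ univ ∩ (fun z : P × ℝ => w z.1 z.2) ⁻¹' φ.source
  have hO₁ : IsOpen O₁ := hw.smooth.continuousOn.isOpen_inter_preimage hw.isOpen_prod φ.open_source
  set g : P × ℝ → Model n := fun z => φ (w z.1 z.2) + D z.1 z.2 with hg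
  have hgs : ContMDiffOn 𝓘(ℝ, P × ℝ) (𝓡 n) ∞ g O₁ := by
    have h1 : ContMDiffOn 𝓘(ℝ, P × ℝ) (𝓡 n) ∞ (fun z : P × ℝ => φ (w z.1 z.2)) O₁ :=
      (contMDiffOn_chart (I := 𝓡 n) (x := q)).comp (hw.smooth.mono inter_subset_left)
        fun z hz => hz.2
    exact (h1.contDiffOn.add (hD.mono inter_subset_left)).contMDiffOn
  set O : Set (P × ℝ) := O₁ ∩ g ⁻¹' φ.target
  have hO : IsOpen O := hgs.continuousOn.isOpen_inter_preimage hO₁ φ.open_target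
  have hOs : ContMDiffOn 𝓘(ℝ, P × ℝ) (𝓡 n) ∞ (fun z => φ.symm (g z)) O :=
    (contMDiffOn_chart_symm (I := 𝓡 n) (x := q)).comp (hgs.mono inter_subset_left)
      fun z hz => hz.2
  obtain ⟨V, hVU, hV, h0V, hVA⟩ := exists_tube hw.isOpen hw.zero_mem hA hAper (O := O)
    (fun s hs => hO.mem_nhds ⟨⟨⟨hw.zero_mem, mem_univ s⟩, hsrc s hs⟩, by
      simp only [hg, mem_preimage, hD0, add_zero]
      exact φ.map_source (hsrc s hs)⟩)
    (fun p hp s => by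
      have h1 : w p (s + 1) = w p s := hw.periodic p hp s
      simp [O, O₁, hg, h1, hDper p hp s])
  refine ⟨V, hVU, ⟨hV, h0V, fun p hp s => ?_, ?_⟩, fun p hp s hs => ?_⟩
  · have h1 : w p (s + 1) = w p s := hw.periodic p (hVU hp) s
    by_cases hs : s ∈ A
    · rw [chartPush_of_mem hs, chartPush_of_mem ((hAper s).2 hs), h1, hDper p (hVU hp) s]
    · rw [chartPush_of_notMem hs, chartPush_of_notMem (mt (hAper s).1 hs), h1]
  · rintro ⟨p, s⟩ ⟨hp, -⟩
    by_cases hs : s ∈ A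
    · have hps : (p, s) ∈ O := hVA ⟨hp, hs⟩
      refine ((hOs.contMDiffAt (hO.mem_nhds hps)).congr_of_eventuallyEq ?_).contMDiffWithinAt
      filter_upwards [hO.mem_nhds hps] with z hz
      by_cases hz2 : z.2 ∈ A
      · exact chartPush_of_mem hz2
      · simp only [chartPush_of_notMem hz2, hg, hDA z.1 hz.1.1.1 z.2 hz2, add_zero]
        exact (φ.left_inv hz.1.2).symm
    · refine ((hw.smooth.contMDiffAt (hw.isOpen_prod.mem_nhds
        ⟨hVU hp, mem_univ s⟩)).congr_of_eventuallyEq ?_).contMDiffWithinAt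
      filter_upwards [(isOpen_univ.prod hA.isOpen_compl).mem_nhds ⟨mem_univ p, hs⟩] with z hz
      exact chartPush_of_notMem hz.2
  · have := hVA (⟨hp, hs⟩ : (p, s) ∈ V ×ˢ A)
    exact ⟨this.1.2, this.2⟩

end Family

/-! ### Families with a prescribed variation field -/

section AddField

variable {n : ℕ} {M : Type*} [TopologicalSpace M] [ChartedSpace (Model n) M]
  {P : Type} [NormedAddCommGroup P] [NormedSpace ℝ P]
  {U : Set P} {w : P → ℝ → M}

variable (n) in
/-- `w'` extends the family `w` by one parameter, with velocity `X` in the new direction at the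
times in `J`. -/
structure IsExtension (w : P → ℝ → M) (X : ℝ → TangentBundle (𝓡 n) M) (J : Set ℝ)
    (V : Set (P × ℝ)) (w' : P × ℝ → ℝ → M) : Prop where
  family : IsFamily n V w'
  restrict : ∀ p, (p, (0 : ℝ)) ∈ V → w' (p, 0) = w p
  velocity : ∀ s ∈ J, velocity (fun r : ℝ => w' (r • ((0 : P), (1 : ℝ))) s) 0 = X s

theorem IsExtension.apply_zero {X : ℝ → TangentBundle (𝓡 n) M} {J : Set ℝ} {V : Set (P × ℝ)}
    {w' : P × ℝ → ℝ → M} (h : IsExtension n w X J V w') : w' 0 = w 0 :=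
  h.restrict 0 h.family.zero_mem

theorem continuous_of_isFamily (hw : IsFamily n U w) : Continuous (w 0) := by
  rw [← continuousOn_univ]
  exact hw.smooth.continuousOn.comp (f := fun s : ℝ => ((0 : P), s)) (by fun_prop)
    fun s _ => ⟨hw.zero_mem, mem_univ s⟩

theorem IsFamily.exists_chart_bump (hw : IsFamily n U w) (c : ℝ) :
    ∃ (ρ : ℝ → ℝ) (A : Set ℝ), ContDiff ℝ ∞ ρ ∧ (∀ s, ρ (s + 1) = ρ s) ∧ IsClosed A ∧
      (∀ s, s + 1 ∈ A ↔ s ∈ A) ∧ (∀ s ∈ A, w 0 s ∈ (chartAt (Model n) (w 0 c)).source) ∧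
      (∀ s ∉ A, ρ s = 0) ∧ ∀ᶠ s in 𝓝 c, ρ s = 1 := by
  obtain ⟨ρ, A, h1, h2, h3, h4, h5, h6, h7⟩ := exists_periodic_bump
    (O := w 0 ⁻¹' (chartAt (Model n) (w 0 c)).source) (c := c)
    (fun s => by rw [mem_preimage, mem_preimage, hw.periodic 0 hw.zero_mem s])
    ((continuous_of_isFamily hw).continuousAt.preimage_mem_nhds
      ((chartAt (Model n) (w 0 c)).open_source.mem_nhds (mem_chart_source _ _)))
  exact ⟨ρ, A, h1, h2, h3, h4, h5, h6, h7⟩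

variable [IsManifold (𝓡 n) ∞ M]

/-- Off `A` the loop may leave the chart and `chartVec` loses its meaning, but `ρ` is zero there. -/
theorem contDiff_bump_smul_chartVec {x : ℝ → M} (hx : Continuous x) {q : M} {ρ : ℝ → ℝ} {A : Set ℝ}
    (hρ : ContDiff ℝ ∞ ρ) (hA : IsClosed A) (hsrc : ∀ s ∈ A, x s ∈ (chartAt (Model n) q).source)
    (hρA : ∀ s ∉ A, ρ s = 0) {X : ℝ → TangentBundle (𝓡 n) M}
    (hX : ContMDiff 𝓘(ℝ, ℝ) (𝓡 n).tangent ∞ X) (hXx : ∀ s, (X s).1 = x s) :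
    ContDiff ℝ ∞ fun s => ρ s • chartVec q (X s) := by
  have hO : IsOpen (x ⁻¹' (chartAt (Model n) q).source) :=
    (chartAt (Model n) q).open_source.preimage hx
  rw [contDiff_iff_contDiffAt]
  intro s
  by_cases hs : s ∈ A
  · have h1 : ContMDiffOn 𝓘(ℝ, ℝ) 𝓘(ℝ, Model n) ∞ (fun s => chartVec q (X s))
        (x ⁻¹' (chartAt (Model n) q).source) :=
      (contMDiffOn_chartVec q).comp hX.contMDiffOn fun s hs => by
        change (X s).1 ∈ (chartAt (Model n) q).source
        rw [hXx]; exact hs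
    exact hρ.contDiffAt.smul (h1.contDiffOn.contDiffAt (hO.mem_nhds (hsrc s hs)))
  · refine contDiffAt_const (c := (0 : Model n)) |>.congr_of_eventuallyEq ?_
    filter_upwards [hA.isOpen_compl.mem_nhds hs] with t ht
    rw [hρA t ht, zero_smul]

/-- If `Y` is the present velocity in the new direction, adding `p.2 • ρ (X - Y)` in the chart
changes it to `X` where `ρ = 1`. On `J` the correction is zero because `Y = X` already, so progress
made in other charts is kept. -/
theorem IsExtension.exists_union_nhds {X : ℝ → TangentBundle (𝓡 n) M}
    (hX : ContMDiff 𝓘(ℝ, ℝ) (𝓡 n).tangent ∞ X) (hXper : Function.Periodic X 1)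
    (hXw : ∀ s, (X s).1 = w 0 s) {J : Set ℝ} {V : Set (P × ℝ)} {w' : P × ℝ → ℝ → M}
    (h : IsExtension n w X J V w') {q : M} {ρ : ℝ → ℝ} {A : Set ℝ}
    (hρ : ContDiff ℝ ∞ ρ) (hρper : ∀ s, ρ (s + 1) = ρ s) (hA : IsClosed A)
    (hAper : ∀ s, s + 1 ∈ A ↔ s ∈ A) (hsrc : ∀ s ∈ A, w 0 s ∈ (chartAt (Model n) q).source)
    (hρA : ∀ s ∉ A, ρ s = 0) :
    ∃ (V' : Set (P × ℝ)) (w'' : P × ℝ → ℝ → M), IsExtension n w X (J ∪ {s | ρ s = 1}) V' w'' := by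
  set Y : ℝ → TangentBundle (𝓡 n) M :=
    fun s => FreePeriod.velocity (fun r : ℝ => w' (r • ((0 : P), (1 : ℝ))) s) 0 with hY
  have hYw : ∀ s, (Y s).1 = w 0 s := fun s => by
    change w' ((0 : ℝ) • ((0 : P), (1 : ℝ))) s = w 0 s
    rw [zero_smul, h.apply_zero]
  set W : ℝ → Model n := fun s => ρ s • chartVec q (X s) - ρ s • chartVec q (Y s) with hW
  have hx : Continuous (w 0) := h.apply_zero ▸ continuous_of_isFamily h.family
  have hWs : ContDiff ℝ ∞ W :=
    (contDiff_bump_smul_chartVec hx hρ hA hsrc hρA hX hXw).sub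
      (contDiff_bump_smul_chartVec hx hρ hA hsrc hρA (h.family.contMDiff_velocity _) hYw)
  have hsrc' : ∀ s ∈ A, w' 0 s ∈ (chartAt (Model n) q).source := by rwa [h.apply_zero]
  obtain ⟨V', hV', hfam, htgt⟩ := h.family.exists_chartPush hA hAper hsrc'
    (D := fun p s => p.2 • W s)
    (ContDiff.contDiffOn (by fun_prop))
    (fun p _ s => by
      have h1 : Y (s + 1) = Y s := h.family.periodic_velocity _ s
      simp only [hW, hρper, hXper s, h1])
    (fun s => zero_smul _ _) (fun p _ s hs => by simp [hW, hρA s hs])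
  refine ⟨V', _, hfam, fun p hp => ?_, fun s hs => ?_⟩
  · ext s
    rw [← h.restrict p (hV' hp)]
    by_cases hs : s ∈ A
    · rw [chartPush_of_mem hs, zero_smul, add_zero]
      exact (chartAt (Model n) q).left_inv (htgt _ hp s hs).1
    · exact chartPush_of_notMem hs
  · by_cases hsA : s ∈ A
    · have hbase : chartPush q A w' (fun p s => p.2 • W s) 0 s = w 0 s := by
        rw [chartPush_of_mem hsA, h.apply_zero]
        simpa using (chartAt (Model n) q).left_inv (hsrc s hsA)
      have key : chartVec q (FreePeriod.velocity (fun r : ℝ => chartPush q A w'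
          (fun p s => p.2 • W s) (r • ((0 : P), (1 : ℝ))) s) 0 : TangentBundle (𝓡 n) M) =
          chartVec q (X s) := by
        rw [hfam.chartVec_velocity (hbase ▸ hsrc s hsA)]
        have he : (fun p : P × ℝ => chartAt (Model n) q
            (chartPush q A w' (fun p s => p.2 • W s) p s)) =ᶠ[𝓝 0]
            fun p => chartAt (Model n) q (w' p s) + p.2 • W s := by
          filter_upwards [hfam.isOpen.mem_nhds hfam.zero_mem] with p hp
          rw [chartPush_of_mem hsA]
          exact (chartAt (Model n) q).right_inv (htgt p hp s hsA).2
        have hd : HasFDerivAt (fun p : P × ℝ => p.2 • W s)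
            ((ContinuousLinearMap.snd ℝ P ℝ).smulRight (W s)) 0 :=
          (ContinuousLinearMap.snd ℝ P ℝ).hasFDerivAt.smul_const (W s)
        rw [he.fderiv_eq, ((h.family.differentiableAt_chart (hsrc' s hsA)).hasFDerivAt.fun_add
          hd).fderiv, add_apply,
          ← h.family.chartVec_velocity (hsrc' s hsA)]
        change chartVec q (Y s) + (1 : ℝ) • W s = _
        rw [one_smul]
        rcases hs with hs | hs
        · simp [hW, show Y s = X s from h.velocity s hs]
        · simp [hW, mem_ofPred_eq ▸ hs]
      have hb : chartPush q A w' (fun p s => p.2 • W s) ((0 : ℝ) • ((0 : P), (1 : ℝ))) s =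
          w 0 s := by
        rw [zero_smul, hbase]
      exact eq_of_chartVec_eq (hb.trans (hXw s).symm) (mem_of_eq_of_mem hb (hsrc s hsA)) key
    · have h1 : s ∈ J := hs.resolve_right fun h1 => by
        have h2 : ρ s = 1 := h1
        simp [hρA s hsA] at h2
      rw [← h.velocity s h1]
      simp only [chartPush_of_notMem hsA]

/-- Starting from the family that ignores the new parameter, finitely many chart corrections cover
`[0, 1]`; periodicity gives the remaining times. -/
theorem IsFamily.exists_extension (hw : IsFamily n U w) {X : ℝ → TangentBundle (𝓡 n) M}
    (hX : ContMDiff 𝓘(ℝ, ℝ) (𝓡 n).tangent ∞ X) (hXper : Function.Periodic X 1)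
    (hXw : ∀ s, (X s).1 = w 0 s) :
    ∃ (V : Set (P × ℝ)) (w' : P × ℝ → ℝ → M), IsExtension n w X univ V w' := by
  have key : ∀ J : Set ℝ, ∀ (V : Set (P × ℝ)) (w' : P × ℝ → ℝ → M), IsExtension n w X J V w' →
      ∃ (V' : Set (P × ℝ)) (w'' : P × ℝ → ℝ → M), IsExtension n w X (J ∪ Icc 0 1) V' w'' := by
    refine isCompact_Icc.induction_on (p := fun K => ∀ J : Set ℝ, ∀ (V : Set (P × ℝ))
      (w' : P × ℝ → ℝ → M), IsExtension n w X J V w' →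
      ∃ (V' : Set (P × ℝ)) (w'' : P × ℝ → ℝ → M), IsExtension n w X (J ∪ K) V' w'')
      ?_ ?_ ?_ ?_
    · intro J V w' h
      exact ⟨V, w', by rwa [union_empty]⟩
    · intro K K' hK h J V w' hJ
      obtain ⟨V', w'', h'⟩ := h J V w' hJ
      exact ⟨V', w'', h'.family, h'.restrict, fun s hs =>
        h'.velocity s (union_subset_union_right _ hK hs)⟩
    · intro K K' h1 h2 J V w' hJ
      obtain ⟨V', w'', h'⟩ := h1 J V w' hJ
      rw [← union_assoc]
      exact h2 _ V' w'' h'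
    · intro c _
      obtain ⟨ρ, A, h1, h2, h3, h4, h5, h6, h7⟩ := hw.exists_chart_bump c
      exact ⟨_, mem_nhdsWithin_of_mem_nhds h7, fun J V w' hJ =>
        hJ.exists_union_nhds hX hXper hXw h1 h2 h3 h4 h5 h6⟩
  obtain ⟨V, w', h⟩ := key ∅ (U ×ˢ univ) (fun p => w p.1)
    ⟨hw.comp (hw.isOpen.prod isOpen_univ) ⟨hw.zero_mem, mem_univ _⟩ contDiffOn_fst
      fun p hp => hp.1, fun _ _ => rfl, fun _ hs => hs.elim⟩
  refine ⟨V, w', h.family, h.restrict, fun s _ => ?_⟩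
  obtain ⟨k, t, ht, rfl⟩ := exists_mem_Icc_of_periodic s
  have h1 := (h.family.periodic_velocity ((0 : P), (1 : ℝ))).int_mul k t
  have h2 := hXper.int_mul k t
  simp only [mul_one] at h1 h2
  rw [h2, ← h.velocity t (Or.inr ht)]
  exact h1

end AddField

/-! ### The action on families -/

section Action

theorem two_le_infty : (2 : WithTop ℕ∞) ≤ ∞ :=
  WithTop.coe_le_coe.2 (le_top : (2 : ℕ∞) ≤ ⊤)

variable {n : ℕ} {M : Type*} [TopologicalSpace M] [ChartedSpace (Model n) M]
  {P Q : Type} [NormedAddCommGroup P] [NormedSpace ℝ P] [NormedAddCommGroup Q] [NormedSpace ℝ Q]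
  {U : Set P} {w : P → ℝ → M} {θ : P → ℝ} {L : TangentBundle (𝓡 n) M → ℝ} {κ : ℝ} {x : ℝ → M}
  {T : ℝ}

variable (n) in
/-- A smooth family of pairs (loop, period) through `(x, T)`. -/
structure IsPairFamily (x : ℝ → M) (T : ℝ) (U : Set P) (w : P → ℝ → M) (θ : P → ℝ) : Prop where
  family : IsFamily n U w
  start : w 0 = x
  smooth_period : ContDiffOn ℝ ∞ θ U
  start_period : θ 0 = T

theorem IsPairFamily.comp (hw : IsPairFamily n x T U w θ) {h : Q → P} {V : Set Q} (hV : IsOpen V)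
    (hV0 : 0 ∈ V) (hh : ContDiffOn ℝ ∞ h V) (hm : MapsTo h V U) (h0 : h 0 = 0) :
    IsPairFamily n x T V (fun p => w (h p)) (fun p => θ (h p)) where
  family := hw.family.comp hV hV0 hh hm
  start := by rw [h0, hw.start]
  smooth_period := hw.smooth_period.comp hh hm
  start_period := by rw [h0, hw.start_period]

theorem IsPairFamily.exists_comp (hw : IsPairFamily n x T U w θ) {h : Q → P}
    (hh : ContDiff ℝ ∞ h) (h0 : h 0 = 0) :
    ∃ V, IsPairFamily n x T V (fun p => w (h p)) (fun p => θ (h p)) :=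
  ⟨h ⁻¹' U, hw.comp (hw.family.isOpen.preimage hh.continuous) (by simpa [h0] using hw.family.zero_mem)
    hh.contDiffOn (mapsTo_preimage h U) h0⟩

theorem IsPairFamily.isVariation {V : Set ℝ} {u : ℝ → ℝ → M} {θ : ℝ → ℝ}
    (h : IsPairFamily n x T V u θ) : IsVariation n x u :=
  h.start ▸ h.family.isVariation

theorem IsPairFamily.isPeriodVariation {V : Set ℝ} {u : ℝ → ℝ → M} {θ : ℝ → ℝ}
    (h : IsPairFamily n x T V u θ) : IsPeriodVariation T θ := by
  obtain ⟨δ, hδ, hV⟩ := exists_Ioo_subset (h.family.isOpen.mem_nhds h.family.zero_mem)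
  exact ⟨h.start_period, δ, hδ, h.smooth_period.mono hV⟩

variable [IsManifold (𝓡 n) ∞ M]

theorem IsPairFamily.contDiffAt_action (hw : IsPairFamily n x T U w θ)
    (hL : ContMDiff (𝓡 n).tangent 𝓘(ℝ, ℝ) ∞ L) (hT : 0 < T) :
    ContDiffAt ℝ ∞ (fun p => action L κ (w p) (θ p)) 0 := by
  set V : Set P := U ∩ θ ⁻¹' Ioi 0
  have hV : IsOpen V := hw.smooth_period.continuousOn.isOpen_inter_preimage hw.family.isOpen
    isOpen_Ioi
  have h0 : (0 : P) ∈ V := ⟨hw.family.zero_mem, by simpa [hw.start_period] using hT⟩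
  have hθ : ContDiffOn ℝ ∞ θ V := hw.smooth_period.mono inter_subset_left
  have hinv : ContDiffOn ℝ ∞ (fun z : P × ℝ => (θ z.1)⁻¹) (V ×ˢ univ) :=
    (hθ.inv fun p hp => ne_of_gt hp.2).comp contDiffOn_fst fun z hz => hz.1
  have h1 := contMDiffOn_tangentMap hw.family.isOpen_prod hw.family.smooth
    (c := fun z : P × ℝ => z) (c' := fun z => (0, (θ z.1)⁻¹)) contDiffOn_id
    (contDiffOn_const.prodMk hinv) (fun z hz => ⟨hz.1.1, mem_univ _⟩)
  have h2 : ContDiffOn ℝ ∞ (fun z : P × ℝ => L (scaledVelocity (θ z.1)⁻¹ (w z.1) z.2) + κ)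
      (V ×ˢ univ) := by
    refine (ContMDiffOn.contDiffOn ?_).add contDiffOn_const
    refine (hL.comp_contMDiffOn h1).congr fun z hz => ?_
    rw [hw.family.scaledVelocity_eq hz.1.1]
    rfl
  have h3 := contDiffOn_intervalIntegral hV (hV.prod isOpen_univ)
    (prod_mono_right (subset_univ _)) h2
  exact (hθ.mul h3).contDiffAt (hV.mem_nhds h0)

theorem iteratedDeriv_two_comp {F : P → ℝ} {c : ℝ → P} (hc : ContDiffAt ℝ 2 c 0)
    (hF : ContDiffAt ℝ 2 F (c 0)) :
    iteratedDeriv 2 (fun r => F (c r)) 0 =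
      fderiv ℝ (fderiv ℝ F) (c 0) (deriv c 0) (deriv c 0) +
        fderiv ℝ F (c 0) (deriv (deriv c) 0) := by
  have h1 : ∀ᶠ r in 𝓝 0, HasDerivAt (fun r => F (c r)) (fderiv ℝ F (c r) (deriv c r)) r := by
    filter_upwards [hc.eventually (by simp), hc.continuousAt.eventually (hF.eventually (by simp))]
      with r h1 h2
    exact (h2.differentiableAt (by simp)).hasFDerivAt.comp_hasDerivAt r
      (h1.differentiableAt (by simp)).hasDerivAt
  have h2 : deriv (fun r => F (c r)) =ᶠ[𝓝 0] fun r => fderiv ℝ F (c r) (deriv c r) :=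
    h1.mono fun r hr => hr.deriv
  have hc1 : DifferentiableAt ℝ (deriv c) 0 :=
    ((hc.fderiv_right (m := 1) (by norm_num)).differentiableAt (by simp)).clm_apply
      (differentiableAt_const (1 : ℝ))
  have hF1 : DifferentiableAt ℝ (fderiv ℝ F) (c 0) :=
    (hF.fderiv_right (m := 1) (by norm_num)).differentiableAt (by simp)
  rw [iteratedDeriv_succ, iteratedDeriv_one, h2.deriv_eq]
  exact ((hF1.hasFDerivAt.comp_hasDerivAt (0 : ℝ)
    (hc.differentiableAt (by simp)).hasDerivAt).clm_apply hc1.hasDerivAt).deriv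

theorem IsCriticalPoint.fderiv_eq_zero (hx : IsCriticalPoint L κ x T)
    (hL : ContMDiff (𝓡 n).tangent 𝓘(ℝ, ℝ) ∞ L) (hw : IsPairFamily n x T U w θ) :
    fderiv ℝ (fun p => action L κ (w p) (θ p)) 0 = 0 := by
  ext a
  obtain ⟨V, hV⟩ := hw.exists_comp (h := fun r : ℝ => r • a) (by fun_prop) (by simp)
  have h1 := hx.critical _ _ hV.isVariation hV.isPeriodVariation
  have hc : HasDerivAt (fun r : ℝ => r • a) a 0 := by
    simpa using (hasDerivAt_id (0 : ℝ)).smul_const a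
  have h2 : HasFDerivAt (fun p => action L κ (w p) (θ p))
      (fderiv ℝ (fun p => action L κ (w p) (θ p)) 0) ((0 : ℝ) • a) := by
    rw [zero_smul]
    exact ((hw.contDiffAt_action hL hx.pos).differentiableAt (by simp)).hasFDerivAt
  exact (h2.comp_hasDerivAt (f := fun r : ℝ => r • a) (0 : ℝ) hc).unique h1

/-- The Hessian at `0` of the action, along a family through a critical point. -/
def hessian (L : TangentBundle (𝓡 n) M → ℝ) (κ : ℝ) (w : P → ℝ → M) (θ : P → ℝ) :
    P →L[ℝ] P →L[ℝ] ℝ :=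
  fderiv ℝ (fderiv ℝ (fun p => action L κ (w p) (θ p))) 0

/-- The second-order chain rule has a term linear in the acceleration of `c`, which criticality
kills; only the velocity of `c` is left. -/
theorem IsCriticalPoint.iteratedDeriv_two (hx : IsCriticalPoint L κ x T)
    (hL : ContMDiff (𝓡 n).tangent 𝓘(ℝ, ℝ) ∞ L) (hw : IsPairFamily n x T U w θ) {c : ℝ → P}
    (hc : ContDiffAt ℝ 2 c 0) (h0 : c 0 = 0) :
    iteratedDeriv 2 (fun r => action L κ (w (c r)) (θ (c r))) 0 =
      hessian L κ w θ (deriv c 0) (deriv c 0) := by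
  have hF : ContDiffAt ℝ 2 (fun p => action L κ (w p) (θ p)) (c 0) := by
    rw [h0]; exact (hw.contDiffAt_action hL hx.pos).of_le two_le_infty
  rw [iteratedDeriv_two_comp hc hF, h0, hx.fderiv_eq_zero hL hw]
  simp [hessian]

theorem IsPairFamily.hessian_symm (hw : IsPairFamily n x T U w θ)
    (hL : ContMDiff (𝓡 n).tangent 𝓘(ℝ, ℝ) ∞ L) (hT : 0 < T) (a b : P) :
    hessian L κ w θ a b = hessian L κ w θ b a :=
  ((hw.contDiffAt_action hL hT).isSymmSndFDerivAt (by simpa using two_le_infty)) a b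

/-- At a critical point the second derivative of the action depends on the variation of the period
only through its velocity. -/
theorem IsCriticalPoint.iteratedDeriv_two_period (hx : IsCriticalPoint L κ x T)
    (hL : ContMDiff (𝓡 n).tangent 𝓘(ℝ, ℝ) ∞ L) {u : ℝ → ℝ → M} {θ θ' : ℝ → ℝ}
    (hu : IsVariation n x u) (hθ : IsPeriodVariation T θ) (hθ' : IsPeriodVariation T θ')
    (h : deriv θ 0 = deriv θ' 0) :
    iteratedDeriv 2 (fun r => action L κ (u r) (θ r)) 0 =
      iteratedDeriv 2 (fun r => action L κ (u r) (θ' r)) 0 := by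
  obtain ⟨δ, hδ, hfam⟩ := hu.exists_isFamily
  -- Treating the period as an independent parameter turns each period variation `η` into the curve
  -- `r ↦ (r, η r - T)` in one family.
  have hw : IsPairFamily n x T (Ioo (-δ) δ ×ˢ (univ : Set ℝ)) (fun p : ℝ × ℝ => u p.1)
      (fun p => T + p.2) :=
    ⟨hfam.comp (isOpen_strip δ) ⟨hfam.zero_mem, mem_univ _⟩ contDiffOn_fst fun p hp => hp.1,
      hu.start, ContDiff.contDiffOn (by fun_prop), by simp⟩
  have key : ∀ η : ℝ → ℝ, IsPeriodVariation T η →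
      iteratedDeriv 2 (fun r => action L κ (u r) (η r)) 0 =
        hessian L κ (fun p : ℝ × ℝ => u p.1) (fun p => T + p.2) (1, deriv η 0) (1, deriv η 0) := by
    intro η hη
    obtain ⟨δ', hδ', hs⟩ := hη.smooth
    have hη1 : ContDiffAt ℝ 2 η 0 :=
      (hs.contDiffAt (Ioo_mem_nhds (by linarith) hδ')).of_le two_le_infty
    have hd : HasDerivAt (fun r => (r, η r - T)) (1, deriv η 0) 0 :=
      (hasDerivAt_id _).prodMk ((hη1.differentiableAt (by simp)).hasDerivAt.sub_const T)
    have := hx.iteratedDeriv_two hL hw (c := fun r => (r, η r - T))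
      (contDiffAt_id.prodMk (hη1.sub contDiffAt_const)) (by simp [hη.start])
    rw [hd.deriv] at this
    simpa using this
  rw [key θ hθ, key θ' hθ', h]

end Action

/-! ### The second derivative of the action depends only on the velocity of the variation -/

section Independence

variable {n : ℕ} {M : Type*} [TopologicalSpace M] [ChartedSpace (Model n) M]
  {L : TangentBundle (𝓡 n) M → ℝ} {κ : ℝ} {x : ℝ → M} {T : ℝ}

/-- The variation `u'` has the same velocity and the same second variation of the action as `u`,
and it coincides with `v` at the times in `J`. -/
structure IsAdjustment (L : TangentBundle (𝓡 n) M → ℝ) (κ : ℝ) (θ : ℝ → ℝ) (u v : ℝ → ℝ → M) (J : Set ℝ)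
    (u' : ℝ → ℝ → M) : Prop where
  variation : IsVariation n (u 0) u'
  velocity : ∀ s, (velocity (fun r => u' r s) 0 : TangentBundle (𝓡 n) M) =
    velocity (fun r => u r s) 0
  second_deriv : iteratedDeriv 2 (fun r => action L κ (u' r) (θ r)) 0 =
    iteratedDeriv 2 (fun r => action L κ (u r) (θ r)) 0
  eq_on : ∀ᶠ r in 𝓝 0, ∀ s ∈ J, u' r s = v r s

theorem IsAdjustment.trans {u v u' u'' : ℝ → ℝ → M} {J J' : Set ℝ}
    (h : IsAdjustment L κ θ u v J u') (h' : IsAdjustment L κ θ u' v J' u'') :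
    IsAdjustment L κ θ u v J' u'' where
  variation := h.variation.start ▸ h'.variation
  velocity s := (h'.velocity s).trans (h.velocity s)
  second_deriv := h'.second_deriv.trans h.second_deriv
  eq_on := h'.eq_on

variable [IsManifold (𝓡 n) ∞ M]

theorem contDiffOn_chart_sub {u v : ℝ → ℝ → M} {V : Set ℝ} (hu : IsFamily n V u)
    (hv : IsFamily n V v) {q : M} {A : Set ℝ} {ρ : ℝ → ℝ} (hρ : ContDiff ℝ ∞ ρ) (hA : IsClosed A)
    (hρA : ∀ s ∉ A, ρ s = 0)
    (hsrc : ∀ r ∈ V, ∀ s ∈ A, u r s ∈ (chartAt (Model n) q).source ∧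
      v r s ∈ (chartAt (Model n) q).source) :
    ContDiffOn ℝ ∞ (fun z : ℝ × ℝ => ρ z.2 • (chartAt (Model n) q (v z.1 z.2) -
      chartAt (Model n) q (u z.1 z.2))) (V ×ˢ univ) := by
  rintro ⟨r, s⟩ ⟨hr, -⟩
  refine ContDiffAt.contDiffWithinAt ?_
  by_cases hs : s ∈ A
  · have h : ∀ {y : ℝ → ℝ → M}, IsFamily n V y → y r s ∈ (chartAt (Model n) q).source →
        ContDiffAt ℝ ∞ (fun z : ℝ × ℝ => chartAt (Model n) q (y z.1 z.2)) (r, s) := by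
      intro y hy h1
      have h2 := hy.smooth.contMDiffAt (hy.isOpen_prod.mem_nhds ⟨hr, mem_univ s⟩)
      exact (((contMDiffOn_chart (I := 𝓡 n) (n := ∞) (x := q)).contMDiffAt
        ((chartAt (Model n) q).open_source.mem_nhds h1)).comp (r, s) h2).contDiffAt
    exact (hρ.contDiffAt.comp (r, s) contDiffAt_snd).smul
      ((h hv (hsrc r hr s hs).2).sub (h hu (hsrc r hr s hs).1))
  · refine contDiffAt_const (c := (0 : Model n)) |>.congr_of_eventuallyEq ?_
    filter_upwards [(isOpen_univ.prod hA.isOpen_compl).mem_nhds ⟨mem_univ r, hs⟩] with z hz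
    rw [hρA z.2 hz.2, zero_smul]

/-- In the chart, `u` is moved to `u + ρ (v - u)`. Equal velocities make this a change of order
`r²`, which the second derivative of the action at a critical point cannot detect. -/
theorem IsCriticalPoint.exists_adjustment_chart (hx : IsCriticalPoint L κ x T)
    (hL : ContMDiff (𝓡 n).tangent 𝓘(ℝ, ℝ) ∞ L) {θ : ℝ → ℝ} (hθ : ContDiff ℝ ∞ θ)
    (hθ0 : θ 0 = T) {u v : ℝ → ℝ → M} (hu : IsVariation n x u)
    (hv : IsVariation n x v) (huv : ∀ s, (velocity (fun r => u r s) 0 : TangentBundle (𝓡 n) M) =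
      velocity (fun r => v r s) 0)
    {q : M} {ρ : ℝ → ℝ} {A : Set ℝ} (hρ : ContDiff ℝ ∞ ρ) (hρper : ∀ s, ρ (s + 1) = ρ s)
    (hA : IsClosed A) (hAper : ∀ s, s + 1 ∈ A ↔ s ∈ A)
    (hsrc : ∀ s ∈ A, x s ∈ (chartAt (Model n) q).source) (hρA : ∀ s ∉ A, ρ s = 0)
    {J : Set ℝ} (hJ : ∀ᶠ r in 𝓝 0, ∀ s ∈ J, u r s = v r s) :
    ∃ u', IsAdjustment L κ θ u v (J ∪ {s | ρ s = 1}) u' := by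
  set φ := chartAt (Model n) q
  obtain ⟨δ, hδ, hu1⟩ := hu.exists_isFamily
  obtain ⟨δ', hδ', hv1⟩ := hv.exists_isFamily
  set V : Set ℝ := Ioo (-δ) δ ∩ Ioo (-δ') δ'
  have hV : IsOpen V := isOpen_Ioo.inter isOpen_Ioo
  have hV0 : (0 : ℝ) ∈ V := by simp [V, hδ, hδ']
  have hu2 := hu1.mono hV hV0 inter_subset_left
  have hv2 := hv1.mono hV hV0 inter_subset_right
  obtain ⟨V', hV'V, hV', hV'0, hV'A⟩ := exists_tube hV hV0 hA hAper
    (O := (V ×ˢ univ ∩ (fun z : ℝ × ℝ => u z.1 z.2) ⁻¹' φ.source) ∩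
      (V ×ˢ univ ∩ (fun z : ℝ × ℝ => v z.1 z.2) ⁻¹' φ.source))
    (fun s hs => ((hu2.smooth.continuousOn.isOpen_inter_preimage hu2.isOpen_prod
      φ.open_source).inter (hv2.smooth.continuousOn.isOpen_inter_preimage hv2.isOpen_prod
      φ.open_source)).mem_nhds (by
        simp only [mem_inter_iff, mem_prod, mem_univ, and_true, mem_preimage, hu.start, hv.start]
        exact ⟨⟨hV0, hsrc s hs⟩, hV0, hsrc s hs⟩))
    (fun p hp s => by
      have h1 : u p (s + 1) = u p s := hu2.periodic p hp s
      have h2 : v p (s + 1) = v p s := hv2.periodic p hp s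
      simp [h1, h2])
  obtain ⟨e, he, heV⟩ := exists_Ioo_subset (hV'.mem_nhds hV'0)
  have he0 : (0 : ℝ) ∈ Ioo (-e) e := by simp [he]
  have hu3 := hu2.mono isOpen_Ioo he0 (heV.trans hV'V)
  have hv3 := hv2.mono isOpen_Ioo he0 (heV.trans hV'V)
  have hsrc3 : ∀ r ∈ Ioo (-e) e, ∀ s ∈ A, u r s ∈ φ.source ∧ v r s ∈ φ.source := fun r hr s hs =>
    have h := hV'A (⟨heV hr, hs⟩ : (r, s) ∈ V' ×ˢ A)
    ⟨h.1.2, h.2.2⟩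
  have hmd : ∀ {y : ℝ → ℝ → M}, IsFamily n (Ioo (-e) e) y → ∀ s,
      MDifferentiableAt 𝓘(ℝ, ℝ) (𝓡 n) (fun r => y r s) 0 := fun {y} hy s =>
    MDifferentiableAt.comp (I' := 𝓘(ℝ, ℝ × ℝ)) (g := fun z : ℝ × ℝ => y z.1 z.2)
      (f := fun r : ℝ => (r, s)) 0 (hy.mdifferentiableAt he0 s)
      (differentiableAt_id.prodMk (differentiableAt_const s)).mdifferentiableAt
  have hdiff : ∀ {y : ℝ → ℝ → M}, IsFamily n (Ioo (-e) e) y → ∀ s, y 0 s ∈ φ.source →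
      DifferentiableAt ℝ (fun r => φ (y r s)) 0 := fun hy s hs => hy.differentiableAt_chart hs
  -- The chart expressions of `u` and `v` agree to first order at `r = 0`, so their cut-off
  -- difference is `r² D` with `D` smooth.
  obtain ⟨D, hDs, hDsq, hDper, hDA⟩ := exists_sq_smul_eq
    (f := fun z : ℝ × ℝ => ρ z.2 • (φ (v z.1 z.2) - φ (u z.1 z.2))) he
    (contDiffOn_chart_sub hu3 hv3 hρ hA hρA hsrc3)
    (fun s => by simp [hu.start, hv.start])
    (fun s => by
      by_cases hs : s ∈ A
      · have h1 := hsrc3 0 he0 s hs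
        have h2 : deriv (fun r => φ (u r s)) 0 = deriv (fun r => φ (v r s)) 0 := by
          rw [← chartVec_velocity (hmd hu3 s) h1.1, ← chartVec_velocity (hmd hv3 s) h1.2, huv]
        have h3 := ((hdiff hv3 s h1.2).hasDerivAt.sub
          (hdiff hu3 s h1.1).hasDerivAt).const_smul (ρ s)
        rw [h2, sub_self, smul_zero] at h3
        exact h3.deriv
      · simp [hρA s hs])
    (fun r hr s => by
      have h1 : u r (s + 1) = u r s := hu3.periodic r hr s
      have h2 : v r (s + 1) = v r s := hv3.periodic r hr s
      simp only [h1, h2, hρper])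
    hA (fun r _ s hs => by simp [hρA s hs])
  have hw0 : IsFamily n (Ioo (-e) e ×ˢ (univ : Set ℝ)) (fun p : ℝ × ℝ => u p.1) :=
    hu3.comp (isOpen_strip e) ⟨he0, mem_univ _⟩ contDiffOn_fst fun p hp => hp.1
  obtain ⟨V₂, hV₂, hw, htgt⟩ := hw0.exists_chartPush (q := q) hA hAper
    (D := fun p s => p.2 • D p.1 s)
    (by rw [show (0 : ℝ × ℝ).1 = 0 from rfl, hu.start]; exact hsrc)
    ((by fun_prop : ContDiff ℝ ∞ fun z : (ℝ × ℝ) × ℝ => z.1.2).contDiffOn.smul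
      (hDs.comp (by fun_prop : ContDiff ℝ ∞ fun z : (ℝ × ℝ) × ℝ => (z.1.1, z.2)).contDiffOn
        fun z hz => ⟨hz.1.1, mem_univ _⟩))
    (fun p hp s => by rw [hDper p.1 hp.1])
    (fun s => zero_smul _ _)
    (fun p hp s hs => by rw [hDA p.1 hp.1 s hs, smul_zero])
  set w := chartPush q A (fun p : ℝ × ℝ => u p.1) (fun p s => p.2 • D p.1 s) with hwdef
  have hrest : ∀ r : ℝ, (r, (0 : ℝ)) ∈ V₂ → w (r, 0) = u r := by
    intro r hr
    ext s
    by_cases hs : s ∈ A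
    · rw [hwdef, chartPush_of_mem hs, zero_smul, add_zero]
      exact φ.left_inv (htgt _ hr s hs).1
    · exact chartPush_of_notMem hs
  have hev0 : ∀ᶠ r : ℝ in 𝓝 0, w (r, 0) = u r := by
    filter_upwards [(by fun_prop : Continuous fun r : ℝ => (r, (0 : ℝ))).continuousAt.eventually_mem
      (hw.isOpen.mem_nhds hw.zero_mem)] with r hr using hrest r hr
  have hw00 : w 0 = x := (hrest 0 hw.zero_mem).trans hu.start
  have hpair : IsPairFamily n x T V₂ w (fun p => θ p.1) :=
    ⟨hw, hw00, (hθ.comp contDiff_fst).contDiffOn, hθ0⟩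
  -- In the family `u + a D` with parameters `(r, a)`, the curve `(r, r²)` is the adjusted variation
  -- and `(r, 0)` is `u`. Both have velocity `(1, 0)`, so the action has the same second derivative
  -- along both.
  obtain ⟨V₃, hV₃⟩ := hpair.exists_comp (h := fun r : ℝ => (r, r ^ 2)) (by fun_prop) (by simp)
  have hd1 : HasDerivAt (fun r : ℝ => (r, r ^ 2)) (1, 0) 0 := by
    simpa using (hasDerivAt_id (0 : ℝ)).prodMk (hasDerivAt_pow 2 (0 : ℝ))
  have hd2 : HasDerivAt (fun r : ℝ => (r, (0 : ℝ))) (1, 0) 0 :=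
    (hasDerivAt_id (0 : ℝ)).prodMk (hasDerivAt_const _ _)
  refine ⟨fun r => w (r, r ^ 2), ?_, fun s => ?_, ?_, ?_⟩
  · rw [hu.start]
    exact hV₃.isVariation
  · rw [hw.velocity_eq_smul hd1 (by simp), ← hw.velocity_eq_smul hd2 rfl]
    exact velocity_congr (hev0.mono fun r hr => congrFun hr s)
  · have h1 := hx.iteratedDeriv_two hL hpair (c := fun r : ℝ => (r, r ^ 2))
      (ContDiff.contDiffAt (by fun_prop)) (by simp)
    have h2 := hx.iteratedDeriv_two hL hpair (c := fun r : ℝ => (r, (0 : ℝ)))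
      (ContDiff.contDiffAt (by fun_prop)) rfl
    rw [hd1.deriv] at h1
    rw [hd2.deriv] at h2
    rw [h1, ← h2]
    refine Filter.EventuallyEq.iteratedDeriv_eq 2 ?_
    exact hev0.mono fun r hr => congrArg (fun y => action L κ y (θ r)) hr
  · have hev : ∀ᶠ r : ℝ in 𝓝 0, (r, r ^ 2) ∈ V₂ :=
      (by fun_prop : Continuous fun r : ℝ => (r, r ^ 2)).continuousAt.eventually_mem
        (hw.isOpen.mem_nhds (by simpa using show ((0 : ℝ), (0 : ℝ)) ∈ V₂ from hw.zero_mem))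
    filter_upwards [hJ, hev, Ioo_mem_nhds he0.1 he0.2] with r hrJ hr hre s hs
    by_cases hsA : s ∈ A
    · rw [hwdef, chartPush_of_mem hsA]
      simp only [hDsq r hre s]
      -- On `J` the correction is zero since `u = v` there; where `ρ = 1` it moves `u` exactly to
      -- `v`.
      rcases hs with hs | hs
      · rw [hrJ s hs, sub_self, smul_zero, add_zero]
        exact φ.left_inv (hsrc3 r hre s hsA).2
      · rw [show ρ s = 1 from hs, one_smul, add_sub_cancel]
        exact φ.left_inv (hsrc3 r hre s hsA).2
    · rw [hwdef, chartPush_of_notMem hsA]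
      refine hrJ s (hs.resolve_right fun h1 => ?_)
      have h2 : ρ s = 1 := h1
      simp [hρA s hsA] at h2

/-- At a critical point, the second derivative of the action depends on the variation of the loop
only through its velocity. -/
theorem IsCriticalPoint.iteratedDeriv_two_loop (hx : IsCriticalPoint L κ x T)
    (hL : ContMDiff (𝓡 n).tangent 𝓘(ℝ, ℝ) ∞ L) {θ : ℝ → ℝ} (hθ : ContDiff ℝ ∞ θ)
    (hθ0 : θ 0 = T) {u v : ℝ → ℝ → M} (hu : IsVariation n x u)
    (hv : IsVariation n x v) (huv : ∀ s, (velocity (fun r => u r s) 0 : TangentBundle (𝓡 n) M) =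
      velocity (fun r => v r s) 0) :
    iteratedDeriv 2 (fun r => action L κ (u r) (θ r)) 0 =
      iteratedDeriv 2 (fun r => action L κ (v r) (θ r)) 0 := by
  -- Compactness of `[0, 1]` reduces the passage from `u` to `v` to finitely many adjustments, each
  -- supported in one chart.
  have key : ∀ J : Set ℝ, ∀ u', IsAdjustment L κ θ u v J u' →
      ∃ u'', IsAdjustment L κ θ u v (J ∪ Icc 0 1) u'' := by
    refine isCompact_Icc.induction_on (p := fun K => ∀ J : Set ℝ, ∀ u',
      IsAdjustment L κ θ u v J u' → ∃ u'', IsAdjustment L κ θ u v (J ∪ K) u'') ?_ ?_ ?_ ?_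
    · intro J u' h
      exact ⟨u', by rwa [union_empty]⟩
    · intro K K' hK h J u' hJ
      obtain ⟨u'', h'⟩ := h J u' hJ
      exact ⟨u'', h'.variation, h'.velocity, h'.second_deriv, h'.eq_on.mono fun r hr s hs =>
        hr s (union_subset_union_right _ hK hs)⟩
    · intro K K' h1 h2 J u' hJ
      obtain ⟨u'', h'⟩ := h1 J u' hJ
      rw [← union_assoc]
      exact h2 _ u'' h'
    · intro c _
      obtain ⟨δ, -, hfam⟩ := hu.exists_isFamily
      obtain ⟨ρ, A, h1, h2, h3, h4, h5, h6, h7⟩ := hfam.exists_chart_bump c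
      refine ⟨_, mem_nhdsWithin_of_mem_nhds h7, fun J u' hJ => ?_⟩
      rw [hu.start] at h5
      obtain ⟨u'', h⟩ := hx.exists_adjustment_chart hL hθ hθ0 (hu.start ▸ hJ.variation) hv
        (fun s => (hJ.velocity s).trans (huv s)) h1 h2 h3 h4 h5 h6 hJ.eq_on
      exact ⟨u'', hJ.trans h⟩
  obtain ⟨u', h⟩ := key ∅ u ⟨hu.start.symm ▸ hu, fun _ => rfl, rfl, by simp⟩
  rw [← h.second_deriv]
  refine Filter.EventuallyEq.iteratedDeriv_eq 2 ?_
  obtain ⟨δ, hδ, hu1⟩ := h.variation.exists_isFamily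
  obtain ⟨δ', hδ', hv1⟩ := hv.exists_isFamily
  filter_upwards [h.eq_on, hu1.isOpen.mem_nhds hu1.zero_mem, hv1.isOpen.mem_nhds hv1.zero_mem]
    with r hr hru hrv
  have : u' r = v r := by
    ext s
    obtain ⟨k, t, ht, rfl⟩ := exists_mem_Icc_of_periodic s
    have h1 := (hu1.periodic r hru).int_mul k t
    have h2 := (hv1.periodic r hrv).int_mul k t
    simp only [mul_one] at h1 h2
    rw [h1, h2, hr t (Or.inr ht)]
  rw [this]

/-- Both period variations are first replaced by the affine one with the same slope, which is smooth
on all of `ℝ` as the comparison of loops requires. -/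
theorem IsCriticalPoint.iteratedDeriv_two_eq (hx : IsCriticalPoint L κ x T)
    (hL : ContMDiff (𝓡 n).tangent 𝓘(ℝ, ℝ) ∞ L) {u v : ℝ → ℝ → M} {θ η : ℝ → ℝ}
    (hu : IsVariation n x u) (hv : IsVariation n x v) (hθ : IsPeriodVariation T θ)
    (hη : IsPeriodVariation T η)
    (huv : ∀ s, (velocity (fun r => u r s) 0 : TangentBundle (𝓡 n) M) =
      velocity (fun r => v r s) 0) (hd : deriv θ 0 = deriv η 0) :
    iteratedDeriv 2 (fun r => action L κ (u r) (θ r)) 0 =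
      iteratedDeriv 2 (fun r => action L κ (v r) (η r)) 0 := by
  have hd0 : deriv (fun r : ℝ => T + deriv θ 0 * r) 0 = deriv θ 0 := by simp
  have hs : ContDiff ℝ ∞ fun r : ℝ => T + deriv θ 0 * r := by fun_prop
  have hp : IsPeriodVariation T fun r => T + deriv θ 0 * r :=
    ⟨by simp, 1, one_pos, hs.contDiffOn⟩
  rw [hx.iteratedDeriv_two_period hL hu hθ hp hd0.symm,
    hx.iteratedDeriv_two_period hL hv hη hp (hd.symm.trans hd0.symm),
    hx.iteratedDeriv_two_loop hL hs (by simp) hu hv huv]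

end Independence

/-! ### Negative index of a symmetric bilinear form -/

section NegIndex

variable {E : Type*} [AddCommGroup E] [Module ℝ E]

/-- `B` is negative definite on `N`. -/
def IsNegDefOn (B : LinearMap.BilinForm ℝ E) (N : Submodule ℝ E) : Prop :=
  ∀ v ∈ N, v ≠ 0 → B v v < 0

/-- The largest dimension of a subspace of `K` on which `B` is negative definite. -/
def negIndex (B : LinearMap.BilinForm ℝ E) (K : Submodule ℝ E) : ℕ∞ :=
  sSup {k : ℕ∞ | ∃ N ≤ K, IsNegDefOn B N ∧ FiniteDimensional ℝ N ∧
    k = (Module.finrank ℝ N : ℕ∞)}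

variable {B : LinearMap.BilinForm ℝ E} {K N : Submodule ℝ E}

theorem IsNegDefOn.finrank_le (h : IsNegDefOn B N) (hN : N ≤ K) [FiniteDimensional ℝ N] :
    (Module.finrank ℝ N : ℕ∞) ≤ negIndex B K :=
  le_sSup ⟨N, hN, h, inferInstance, rfl⟩

/-- A nonzero `v` in `N` with `g v = 0` would give `0 ≤ B v v < 0`, so `g` is injective on `N`. -/
theorem IsNegDefOn.finrank_le_of_map (h : IsNegDefOn B N) [FiniteDimensional ℝ N]
    (g : E →ₗ[ℝ] E) (hg : ∀ v ∈ N, B (g v) (g v) ≤ B v v) :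
    IsNegDefOn B (N.map g) ∧ Module.finrank ℝ (N.map g) = Module.finrank ℝ N := by
  refine ⟨?_, ?_⟩
  · rintro _ ⟨v, hv, rfl⟩ h0
    exact (hg v hv).trans_lt (h v hv fun h1 => h0 (by rw [h1, map_zero]))
  · have hinj : Function.Injective (g.domRestrict N) := by
      rw [← LinearMap.ker_eq_bot, LinearMap.ker_eq_bot']
      rintro ⟨v, hv⟩ h1
      by_contra h2
      have h3 : g v = 0 := h1
      have h4 := (hg v hv).trans_lt (h v hv fun h5 => h2 (Subtype.ext h5))
      simp [h3] at h4
    rw [← LinearMap.range_domRestrict, LinearMap.finrank_range_of_inj hinj]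

theorem IsNegDefOn.succ_finrank_le (h : IsNegDefOn B N) [FiniteDimensional ℝ N]
    (hB : ∀ v w, B v w = B w v) {f : E} (hf : B f f < 0) (hfN : ∀ v ∈ N, B f v = 0) :
    (Module.finrank ℝ N : ℕ∞) + 1 ≤ negIndex B ⊤ := by
  set g : N × ℝ →ₗ[ℝ] E := N.subtype.coprod (LinearMap.toSpanSingleton ℝ E f)
  have hg : ∀ z : N × ℝ, z ≠ 0 → B (g z) (g z) < 0 := by
    rintro ⟨⟨v, hv⟩, c⟩ hz
    have h1 : B (g (⟨v, hv⟩, c)) (g (⟨v, hv⟩, c)) = B v v + c ^ 2 * B f f := by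
      have h2 : B v f = 0 := by rw [hB, hfN v hv]
      simp [g, hfN v hv, h2]
      ring
    rw [h1]
    rcases eq_or_ne v 0 with rfl | hv0
    · have hc : c ≠ 0 := fun hc => hz (by simp [hc])
      simpa using mul_neg_of_pos_of_neg (by positivity) hf
    · nlinarith [h v hv hv0, sq_nonneg c]
  have hinj : Function.Injective g := by
    rw [← LinearMap.ker_eq_bot, LinearMap.ker_eq_bot']
    intro z hz
    by_contra h2
    simpa [hz] using hg z h2
  have hneg : IsNegDefOn B (LinearMap.range g) := by
    rintro _ ⟨z, rfl⟩ h0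
    exact hg z fun hz => h0 (by rw [hz, map_zero])
  have := hneg.finrank_le (K := ⊤) le_top
  rw [LinearMap.finrank_range_of_inj hinj, Module.finrank_prod, Module.finrank_self] at this
  exact_mod_cast this

/-- A subspace loses at most one dimension when cut with a hyperplane. -/
theorem negIndex_top_le_ker_add_one (τ : E →ₗ[ℝ] ℝ) :
    negIndex B ⊤ ≤ negIndex B (LinearMap.ker τ) + 1 := by
  refine sSup_le ?_
  rintro _ ⟨N, -, hN, hfd, rfl⟩
  have h1 := LinearMap.finrank_range_add_finrank_ker (τ.domRestrict N)
  have h2 : Module.finrank ℝ (LinearMap.range (τ.domRestrict N)) ≤ 1 :=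
    (Submodule.finrank_le _).trans (Module.finrank_self ℝ).le
  have h3 : IsNegDefOn B ((LinearMap.ker (τ.domRestrict N)).map N.subtype) := by
    rintro _ ⟨⟨v, hv⟩, -, rfl⟩ h0
    exact hN v hv h0
  have h4 := h3.finrank_le (K := LinearMap.ker τ) (by
    rintro _ ⟨⟨v, hv⟩, h5, rfl⟩
    exact h5)
  rw [Submodule.finrank_map_subtype_eq] at h4
  refine le_trans ?_ (add_le_add_left h4 1)
  exact_mod_cast (by omega)

/-- Any negative `N` in ker τ is orthogonal to η. If `τ η > 0`, then `B η η < 0` and η itself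
enlarges `N`; the case `τ η = 0` needs the hyperbolic plane of η and `e`. -/
theorem negIndex_ker_add_one_le (hB : ∀ v w, B v w = B w v) {τ : E →ₗ[ℝ] ℝ} {η e : E}
    (hη : ∀ v, B η v = -τ v) (he : τ e = 1) (hτ : 0 ≤ τ η) :
    negIndex B (LinearMap.ker τ) + 1 ≤ negIndex B ⊤ := by
  have key : ∀ N ≤ LinearMap.ker τ, IsNegDefOn B N → FiniteDimensional ℝ N →
      (Module.finrank ℝ N : ℕ∞) + 1 ≤ negIndex B ⊤ := by
    intro N hN h _
    have hN0 : ∀ v ∈ N, B η v = 0 := fun v hv => by rw [hη, show τ v = 0 from hN hv, neg_zero]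
    rcases hτ.eq_or_lt' with h0 | h0
    -- Here η is isotropic and orthogonal to `N`, so shifting `N` along η leaves B unchanged; as `B
    -- e η = -1`, this shift makes `N` orthogonal to `e` as well.
    · set g : E →ₗ[ℝ] E := LinearMap.id + (LinearMap.toSpanSingleton ℝ E η).comp (B e)
      have hg : ∀ v, g v = v + B e v • η := fun v => rfl
      have hηη : B η η = 0 := by rw [hη, h0, neg_zero]
      have heη : B e η = -1 := by rw [hB, hη, he]
      obtain ⟨h1, h2⟩ := h.finrank_le_of_map g fun v hv => by
        simp [hg, hN0 v hv, hB v η, hηη]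
      rw [← h2]
      -- The coefficient gives `B f f = B e e - (B e e + 1) = -1`.
      refine h1.succ_finrank_le hB (f := e + ((B e e + 1) / 2) • η) ?_ ?_
      · simp only [map_add, map_smul, LinearMap.add_apply, LinearMap.smul_apply, smul_eq_mul,
          hηη, heη, hB η e]
        linarith
      · rintro _ ⟨v, hv, rfl⟩
        simp [hg, hN0 v hv, hηη, heη]
    · exact h.succ_finrank_le hB (by rw [hη]; linarith) hN0
  -- The case `N = 0`. It permits moving the 1 across as a truncated subtraction, so that the
  -- supremum can be bounded termwise.
  have h1 : (1 : ℕ∞) ≤ negIndex B ⊤ := by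
    have := key ⊥ bot_le (fun v hv h0 => absurd hv h0) inferInstance
    simpa using this
  refine add_le_of_le_tsub_right_of_le h1 (sSup_le ?_)
  rintro _ ⟨N, hN, h, hfd, rfl⟩
  exact ENat.le_sub_of_add_le_right ENat.one_ne_top (key N hN h hfd)

/-- Since `B η η = -τ η > 0`, the B-orthogonal projection along η to ker τ lowers `B v v` by `(τ v)²
/ |τ η|`, so it keeps a negative subspace negative and of the same dimension. -/
theorem negIndex_top_le_ker (hB : ∀ v w, B v w = B w v) {τ : E →ₗ[ℝ] ℝ} {η : E}
    (hη : ∀ v, B η v = -τ v) (hτ : τ η < 0) : negIndex B ⊤ ≤ negIndex B (LinearMap.ker τ) := by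
  refine sSup_le ?_
  rintro _ ⟨N, -, h, hfd, rfl⟩
  set g : E →ₗ[ℝ] E := LinearMap.id - (LinearMap.toSpanSingleton ℝ E ((τ η)⁻¹ • η)).comp τ
  have hg : ∀ v, g v = v - τ v • (τ η)⁻¹ • η := fun v => rfl
  obtain ⟨h1, h2⟩ := h.finrank_le_of_map g fun v _ => by
    have h3 : B (g v) (g v) = B v v + (τ v) ^ 2 * (τ η)⁻¹ := by
      simp only [hg, map_sub, map_smul, LinearMap.sub_apply, LinearMap.smul_apply, smul_eq_mul,
        hη, hB v η]
      field_simp [hτ.ne]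
      ring
    rw [h3]
    nlinarith [mul_nonneg (sq_nonneg (τ v)) (neg_nonneg.2 (inv_nonpos.2 hτ.le))]
  rw [← h2]
  refine h1.finrank_le ?_
  rintro _ ⟨v, -, rfl⟩
  simp [hg, hτ.ne]

theorem negIndex_mono {K K' : Submodule ℝ E} (h : K ≤ K') : negIndex B K ≤ negIndex B K' :=
  sSup_le_sSup fun _ ⟨N, hN, h'⟩ => ⟨N, hN.trans h, h'⟩

theorem negIndex_top_eq (hB : ∀ v w, B v w = B w v) {τ : E →ₗ[ℝ] ℝ} {η e : E}
    (hη : ∀ v, B η v = -τ v) (he : τ e = 1) :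
    (0 ≤ τ η → negIndex B ⊤ = negIndex B (LinearMap.ker τ) + 1) ∧
      (τ η < 0 → negIndex B ⊤ = negIndex B (LinearMap.ker τ)) :=
  ⟨fun h => (negIndex_top_le_ker_add_one τ).antisymm (negIndex_ker_add_one_le hB hη he h),
    fun h => (negIndex_top_le_ker hB hη h).antisymm (negIndex_mono le_top)⟩

end NegIndex

/-! ### The second differential of the free-period action -/

section SecondDifferential

variable {n : ℕ} {M : Type*} [TopologicalSpace M] [ChartedSpace (Model n) M]
  {P : Type} [NormedAddCommGroup P] [NormedSpace ℝ P]
  {U : Set P} {w : P → ℝ → M} {θ : P → ℝ} {L : TangentBundle (𝓡 n) M → ℝ} {κ : ℝ} {x : ℝ → M}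
  {T : ℝ}

variable (n) in
/-- Pairs of a vector field along `x`, not necessarily smooth, and a real number. -/
abbrev PairField (x : ℝ → M) : Type := ((s : ℝ) → TangentSpace (𝓡 n) (x s)) × ℝ

/-- The velocity at `0` of the family `(w, θ)` in the direction `a` is `v`. -/
structure HasPairVelocity (w : P → ℝ → M) (θ : P → ℝ) (a : P) (v : PairField n x) : Prop where
  loop : ∀ s, velocity (fun r : ℝ => w (r • a) s) 0 = (⟨x s, v.1 s⟩ : TangentBundle (𝓡 n) M)
  period : fderiv ℝ θ 0 a = v.2

/-- Velocities become values of a derivative, hence linear in the direction `a`. -/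
theorem IsPairFamily.hasPairVelocity_iff (hw : IsPairFamily n x T U w θ) {a : P}
    {v : PairField n x} : HasPairVelocity w θ a v ↔
      (∀ s, (mfderiv 𝓘(ℝ, P × ℝ) (𝓡 n) (fun z : P × ℝ => w z.1 z.2) (0, s) ((a, 0) : P × ℝ) :
        Model n) = v.1 s) ∧ fderiv ℝ θ 0 a = v.2 := by
  have h1 : ∀ s, velocity (fun r : ℝ => w (r • a) s) 0 =
      (⟨x s, v.1 s⟩ : TangentBundle (𝓡 n) M) ↔
      (mfderiv 𝓘(ℝ, P × ℝ) (𝓡 n) (fun z : P × ℝ => w z.1 z.2) (0, s) ((a, 0) : P × ℝ) :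
        Model n) = v.1 s := fun s => by
    rw [hw.family.velocity_smul]
    exact tangent_mk_eq_iff.trans (and_iff_right (congrFun hw.start s))
  exact ⟨fun h => ⟨fun s => (h1 s).1 (h.loop s), h.period⟩,
    fun h => ⟨fun s => (h1 s).2 (h.1 s), h.2⟩⟩

theorem IsPairFamily.hasPairVelocity_add (hw : IsPairFamily n x T U w θ) {a b : P}
    {v v' : PairField n x} (ha : HasPairVelocity w θ a v) (hb : HasPairVelocity w θ b v') :
    HasPairVelocity w θ (a + b) (v + v') := by
  rw [hw.hasPairVelocity_iff] at *
  refine ⟨fun s => ?_, by rw [map_add, ha.2, hb.2]; rfl⟩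
  have h := map_add (mfderiv 𝓘(ℝ, P × ℝ) (𝓡 n) (fun z : P × ℝ => w z.1 z.2) (0, s))
    ((a, 0) : P × ℝ) ((b, 0) : P × ℝ)
  have e : ((a + b, 0) : P × ℝ) = ((a, 0) : P × ℝ) + ((b, 0) : P × ℝ) := by simp
  refine (congrArg (mfderiv 𝓘(ℝ, P × ℝ) (𝓡 n) (fun z : P × ℝ => w z.1 z.2) (0, s)) e).trans
    (h.trans ?_)
  exact congrArg₂ (fun y z : Model n => y + z) (ha.1 s) (hb.1 s)

theorem IsPairFamily.hasPairVelocity_smul (hw : IsPairFamily n x T U w θ) {a : P}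
    {v : PairField n x} (c : ℝ) (ha : HasPairVelocity w θ a v) :
    HasPairVelocity w θ (c • a) (c • v) := by
  rw [hw.hasPairVelocity_iff] at *
  refine ⟨fun s => ?_, by rw [map_smul, ha.2]; rfl⟩
  have h := map_smul (mfderiv 𝓘(ℝ, P × ℝ) (𝓡 n) (fun z : P × ℝ => w z.1 z.2) (0, s)) c
    ((a, 0) : P × ℝ)
  have e : ((c • a, 0) : P × ℝ) = c • ((a, 0) : P × ℝ) := by simp
  refine (congrArg (mfderiv 𝓘(ℝ, P × ℝ) (𝓡 n) (fun z : P × ℝ => w z.1 z.2) (0, s)) e).trans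
    (h.trans ?_)
  exact congrArg (fun y : Model n => c • y) (ha.1 s)

theorem IsSmoothLoop.isPairFamily (hx : IsSmoothLoop n x) (T : ℝ) :
    IsPairFamily n x T univ (fun _ : ℝ => x) (fun _ => T) where
  family := ⟨isOpen_univ, mem_univ _, fun _ _ => hx.periodic,
    (hx.smooth.comp contDiff_snd.contMDiff).contMDiffOn⟩
  start := rfl
  smooth_period := contDiffOn_const
  start_period := rfl

theorem IsPairFamily.exists_variation (hw : IsPairFamily n x T U w θ) {a : P} {v : PairField n x}
    (ha : HasPairVelocity w θ a v) :
    IsVariation n x (fun r : ℝ => w (r • a)) ∧ IsPeriodVariation T (fun r : ℝ => θ (r • a)) ∧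
      HasVariationField x (fun r : ℝ => w (r • a)) v.1 ∧
      deriv (fun r : ℝ => θ (r • a)) 0 = v.2 := by
  obtain ⟨V, hV⟩ := hw.exists_comp (h := fun r : ℝ => r • a) (by fun_prop) (by simp)
  refine ⟨hV.isVariation, hV.isPeriodVariation, ha.loop, ?_⟩
  rw [← ha.period]
  have hc : HasDerivAt (fun r : ℝ => r • a) a 0 := by
    simpa using (hasDerivAt_id (0 : ℝ)).smul_const a
  have h1 : HasFDerivAt θ (fderiv ℝ θ 0) ((0 : ℝ) • a) := by
    rw [zero_smul]
    exact ((hw.smooth_period.contDiffAt (hw.family.isOpen.mem_nhds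
        hw.family.zero_mem)).differentiableAt (by simp)).hasFDerivAt
  exact (h1.comp_hasDerivAt (f := fun r : ℝ => r • a) (0 : ℝ) hc).deriv

open Classical in
/-- The second differential of the free-period action at `(x, T)`, as a function of the velocity of
the variation. -/
def secondDifferential (L : TangentBundle (𝓡 n) M → ℝ) (κ : ℝ) (x : ℝ → M) (T : ℝ)
    (v : PairField n x) : ℝ :=
  -- At a critical point the choice of variation is immaterial, and the default 0 is never met at a
  -- smooth field.
  if h : ∃ z : (ℝ → ℝ → M) × (ℝ → ℝ), IsVariation n x z.1 ∧ IsPeriodVariation T z.2 ∧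
      HasVariationField x z.1 v.1 ∧ deriv z.2 0 = v.2 then
    iteratedDeriv 2 (fun r => action L κ (h.choose.1 r) (h.choose.2 r)) 0
  else 0

/-- The symmetric bilinear form of the second differential. -/
def polarization (L : TangentBundle (𝓡 n) M → ℝ) (κ : ℝ) (x : ℝ → M) (T : ℝ)
    (v v' : PairField n x) : ℝ :=
  (secondDifferential L κ x T (v + v') - secondDifferential L κ x T v -
    secondDifferential L κ x T v') / 2

theorem polarization_comm (v v' : PairField n x) :
    polarization L κ x T v v' = polarization L κ x T v' v := by
  rw [polarization, polarization, add_comm v v']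
  ring

variable [IsManifold (𝓡 n) ∞ M]

theorem IsPairFamily.isFieldAlong (hw : IsPairFamily n x T U w θ) {a : P} {v : PairField n x}
    (h : HasPairVelocity w θ a v) : IsFieldAlong x v.1 where
  smooth := by simpa only [h.loop] using hw.family.contMDiff_velocity a
  periodic := by simpa only [h.loop] using hw.family.periodic_velocity a

/-- The new parameter realizes `v` and the old directions keep their velocities, so iteration
realizes any finite list of tangent vectors in one family. -/
theorem IsPairFamily.exists_extension (hw : IsPairFamily n x T U w θ) {v : PairField n x}
    (hv : IsFieldAlong x v.1) :
    ∃ (V : Set (P × ℝ)) (w' : P × ℝ → ℝ → M),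
      IsPairFamily n x T V w' (fun p => θ p.1 + p.2 * v.2) ∧
      (∀ p, (p, (0 : ℝ)) ∈ V → w' (p, 0) = w p) ∧
      HasPairVelocity w' (fun p => θ p.1 + p.2 * v.2) ((0 : P), (1 : ℝ)) v ∧
      ∀ (a : P) (v' : PairField n x), HasPairVelocity w θ a v' →
        HasPairVelocity w' (fun p => θ p.1 + p.2 * v.2) (a, (0 : ℝ)) v' := by
  obtain ⟨V₀, w', h₀⟩ := hw.family.exists_extension hv.smooth hv.periodic
    fun s => (congrFun hw.start s).symm
  set V : Set (P × ℝ) := V₀ ∩ U ×ˢ univ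
  have hfam : IsFamily n V w' := h₀.family.mono (h₀.family.isOpen.inter hw.family.isOpen_prod)
    ⟨h₀.family.zero_mem, hw.family.zero_mem, mem_univ _⟩ inter_subset_left
  have hθ : ContDiffOn ℝ ∞ (fun p : P × ℝ => θ p.1 + p.2 * v.2) V :=
    (hw.smooth_period.comp contDiffOn_fst fun p hp => hp.2.1).add
      (ContDiff.contDiffOn (by fun_prop))
  have hθd : ∀ a : P × ℝ, fderiv ℝ (fun p : P × ℝ => θ p.1 + p.2 * v.2) 0 a =
      fderiv ℝ θ 0 a.1 + a.2 * v.2 := by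
    intro a
    have h1 : HasFDerivAt θ (fderiv ℝ θ 0) (0 : P × ℝ).1 :=
      ((hw.smooth_period.contDiffAt (hw.family.isOpen.mem_nhds
        hw.family.zero_mem)).differentiableAt (by simp)).hasFDerivAt
    have h2 : HasFDerivAt (fun p : P × ℝ => p.2 * v.2)
        (v.2 • ContinuousLinearMap.snd ℝ P ℝ) 0 :=
      (ContinuousLinearMap.snd ℝ P ℝ).hasFDerivAt.mul_const v.2
    have h3 : HasFDerivAt (fun p : P × ℝ => θ p.1 + p.2 * v.2) _ 0 :=
      (h1.comp (0 : P × ℝ) (ContinuousLinearMap.fst ℝ P ℝ).hasFDerivAt).fun_add h2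
    rw [h3.fderiv]
    simp [mul_comm]
  refine ⟨V, w', ⟨hfam, h₀.apply_zero.trans hw.start, hθ, by simp [hw.start_period]⟩,
    fun p hp => h₀.restrict p hp.1, ⟨fun s => h₀.velocity s (mem_univ s), ?_⟩,
    fun a v' h => ⟨fun s => ?_, ?_⟩⟩
  · rw [hθd]; simp
  · rw [← h.loop s]
    refine velocity_congr ?_
    filter_upwards [(by fun_prop : Continuous fun r : ℝ => r • (a, (0 : ℝ))).continuousAt.eventually_mem
      (hfam.isOpen.mem_nhds (by rw [zero_smul]; exact hfam.zero_mem))] with r hr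
    have e : r • (a, (0 : ℝ)) = (r • a, 0) := by simp
    rw [e] at hr ⊢
    rw [h₀.restrict _ hr.1]
  · rw [hθd, h.period]; simp

/-- The tangent space at `(x, T)` to the space of pairs (loop, period). -/
def admissible (hx : IsSmoothLoop n x) : Submodule ℝ (PairField n x) where
  carrier := {v | IsFieldAlong x v.1}
  -- A two-parameter family realizes both fields; their sum is its velocity in the sum of the two
  -- directions, hence smooth and periodic.
  add_mem' {v v'} hv hv' := by
    obtain ⟨V, w, hw, -, h1, -⟩ := (hx.isPairFamily 1).exists_extension hv
    obtain ⟨V', w', hw', -, h2, h3⟩ := hw.exists_extension hv'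
    exact hw'.isFieldAlong (hw'.hasPairVelocity_add (h3 _ _ h1) h2)
  zero_mem' := by
    have h := hx.isPairFamily 1
    refine h.isFieldAlong (a := 0) (h.hasPairVelocity_iff.2 ⟨fun s => ?_, ?_⟩)
    · exact map_zero (mfderiv 𝓘(ℝ, ℝ × ℝ) (𝓡 n) (fun z : ℝ × ℝ => x z.2) (0, s))
    · simp
  smul_mem' c {v} hv := by
    obtain ⟨V, w, hw, -, h1, -⟩ := (hx.isPairFamily 1).exists_extension hv
    exact hw.isFieldAlong (hw.hasPairVelocity_smul c h1)

theorem IsCriticalPoint.iteratedDeriv_two_eq_secondDifferential (hx : IsCriticalPoint L κ x T)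
    (hL : ContMDiff (𝓡 n).tangent 𝓘(ℝ, ℝ) ∞ L) {v : PairField n x} {u : ℝ → ℝ → M} {η : ℝ → ℝ}
    (hu : IsVariation n x u) (hη : IsPeriodVariation T η) (hv : HasVariationField x u v.1)
    (hd : deriv η 0 = v.2) :
    iteratedDeriv 2 (fun r => action L κ (u r) (η r)) 0 = secondDifferential L κ x T v := by
  have h : ∃ z : (ℝ → ℝ → M) × (ℝ → ℝ), IsVariation n x z.1 ∧ IsPeriodVariation T z.2 ∧
      HasVariationField x z.1 v.1 ∧ deriv z.2 0 = v.2 := ⟨(u, η), hu, hη, hv, hd⟩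
  rw [secondDifferential, dif_pos h]
  obtain ⟨h1, h2, h3, h4⟩ := h.choose_spec
  exact hx.iteratedDeriv_two_eq hL hu h1 hη h2 (fun s => (hv s).trans (h3 s).symm)
    (hd.trans h4.symm)

theorem IsCriticalPoint.hessian_self (hx : IsCriticalPoint L κ x T)
    (hL : ContMDiff (𝓡 n).tangent 𝓘(ℝ, ℝ) ∞ L) (hw : IsPairFamily n x T U w θ) {a : P}
    {v : PairField n x} (ha : HasPairVelocity w θ a v) :
    hessian L κ w θ a a = secondDifferential L κ x T v := by
  obtain ⟨h1, h2, h3, h4⟩ := hw.exists_variation ha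
  rw [← hx.iteratedDeriv_two_eq_secondDifferential hL h1 h2 h3 h4,
    hx.iteratedDeriv_two hL hw (c := fun r : ℝ => r • a) (ContDiff.contDiffAt (by fun_prop))
      (by simp)]
  have hc : HasDerivAt (fun r : ℝ => r • a) a 0 := by
    simpa using (hasDerivAt_id (0 : ℝ)).smul_const a
  rw [hc.deriv]

theorem IsCriticalPoint.polarization_eq (hx : IsCriticalPoint L κ x T)
    (hL : ContMDiff (𝓡 n).tangent 𝓘(ℝ, ℝ) ∞ L) (hw : IsPairFamily n x T U w θ) {a b : P}
    {v v' : PairField n x} (ha : HasPairVelocity w θ a v) (hb : HasPairVelocity w θ b v') :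
    polarization L κ x T v v' = hessian L κ w θ a b := by
  rw [polarization, ← hx.hessian_self hL hw ha, ← hx.hessian_self hL hw hb,
    ← hx.hessian_self hL hw (hw.hasPairVelocity_add ha hb)]
  simp only [map_add, add_apply]
  rw [hw.hessian_symm hL hx.pos b a]
  ring

/-- Additivity in one argument of the polarization involves three vectors, which must lie in a
common family. -/
theorem IsSmoothLoop.exists_family_three (hx : IsSmoothLoop n x) (T : ℝ) {v₁ v₂ v₃ : PairField n x}
    (h₁ : IsFieldAlong x v₁.1) (h₂ : IsFieldAlong x v₂.1) (h₃ : IsFieldAlong x v₃.1) :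
    ∃ (V : Set (((ℝ × ℝ) × ℝ) × ℝ)) (w : ((ℝ × ℝ) × ℝ) × ℝ → ℝ → M)
      (θ : ((ℝ × ℝ) × ℝ) × ℝ → ℝ) (a b c : ((ℝ × ℝ) × ℝ) × ℝ), IsPairFamily n x T V w θ ∧
      HasPairVelocity w θ a v₁ ∧ HasPairVelocity w θ b v₂ ∧ HasPairVelocity w θ c v₃ := by
  obtain ⟨V, w, hw, -, k1, -⟩ := (hx.isPairFamily T).exists_extension h₁
  obtain ⟨V', w', hw', -, k2, k2'⟩ := hw.exists_extension h₂
  obtain ⟨V'', w'', hw'', -, k3, k3'⟩ := hw'.exists_extension h₃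
  exact ⟨V'', w'', _, _, _, _, hw'', k3' _ _ (k2' _ _ k1), k3' _ _ k2, k3⟩

theorem IsCriticalPoint.polarization_add (hx : IsCriticalPoint L κ x T)
    (hL : ContMDiff (𝓡 n).tangent 𝓘(ℝ, ℝ) ∞ L) {v₁ v₂ v₃ : PairField n x}
    (h₁ : IsFieldAlong x v₁.1) (h₂ : IsFieldAlong x v₂.1) (h₃ : IsFieldAlong x v₃.1) :
    polarization L κ x T (v₁ + v₂) v₃ =
      polarization L κ x T v₁ v₃ + polarization L κ x T v₂ v₃ := by
  obtain ⟨V, w, θ, a, b, c, hw, ha, hb, hc⟩ := hx.loop.exists_family_three T h₁ h₂ h₃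
  rw [hx.polarization_eq hL hw (hw.hasPairVelocity_add ha hb) hc, hx.polarization_eq hL hw ha hc,
    hx.polarization_eq hL hw hb hc, map_add, add_apply]

theorem IsCriticalPoint.polarization_smul (hx : IsCriticalPoint L κ x T)
    (hL : ContMDiff (𝓡 n).tangent 𝓘(ℝ, ℝ) ∞ L) (r : ℝ) {v v' : PairField n x}
    (h : IsFieldAlong x v.1) (h' : IsFieldAlong x v'.1) :
    polarization L κ x T (r • v) v' = r * polarization L κ x T v v' := by
  obtain ⟨V, w, θ, a, b, c, hw, ha, hb, -⟩ := hx.loop.exists_family_three T h h' h'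
  rw [hx.polarization_eq hL hw (hw.hasPairVelocity_smul r ha) hb, hx.polarization_eq hL hw ha hb,
    map_smul]
  rfl

theorem IsCriticalPoint.polarization_self (hx : IsCriticalPoint L κ x T)
    (hL : ContMDiff (𝓡 n).tangent 𝓘(ℝ, ℝ) ∞ L) {v : PairField n x} (h : IsFieldAlong x v.1) :
    polarization L κ x T v v = secondDifferential L κ x T v := by
  obtain ⟨V, w, θ, a, b, c, hw, ha, -, -⟩ := hx.loop.exists_family_three T h h h
  rw [hx.polarization_eq hL hw ha ha, hx.hessian_self hL hw ha]

/-- The second differential of the free-period action at a critical point, as a bilinear form. -/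
def IsCriticalPoint.bilinForm (hx : IsCriticalPoint L κ x T)
    (hL : ContMDiff (𝓡 n).tangent 𝓘(ℝ, ℝ) ∞ L) : LinearMap.BilinForm ℝ (admissible hx.loop) :=
  LinearMap.mk₂ ℝ (fun v v' => polarization L κ x T v.1 v'.1)
    (fun v₁ v₂ v₃ => hx.polarization_add hL v₁.2 v₂.2 v₃.2)
    (fun r v v' => hx.polarization_smul hL r v.2 v'.2)
    (fun v₁ v₂ v₃ => by
      simp only [polarization_comm v₁.1]
      exact hx.polarization_add hL v₂.2 v₃.2 v₁.2)
    (fun r v v' => by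
      simp only [polarization_comm v.1]
      exact hx.polarization_smul hL r v'.2 v.2)

end SecondDifferential

/-! ### Morse indices and orbit cylinders -/

section Index

variable {n : ℕ} {M : Type*} [TopologicalSpace M] [ChartedSpace (Model n) M]
  {L : TangentBundle (𝓡 n) M → ℝ} {κ : ℝ} {x : ℝ → M} {T : ℝ}

theorem isPeriodVariation_const (T : ℝ) : IsPeriodVariation T fun _ => T :=
  ⟨rfl, 1, one_pos, contDiffOn_const⟩

theorem IsOrbitCylinder.isPairFamily {ε : ℝ} {y : ℝ → ℝ → M} {p : ℝ → ℝ}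
    (h : IsOrbitCylinder L κ x T ε y p) :
    IsPairFamily n x T (Ioo (-ε) ε) (fun r => y (κ + r)) (fun r => p (κ + r)) := by
  have hm : ∀ r ∈ Ioo (-ε) ε, κ + r ∈ Ioo (κ - ε) (κ + ε) := fun r hr =>
    ⟨by linarith [hr.1], by linarith [hr.2]⟩
  refine ⟨⟨isOpen_Ioo, by simp [h.pos], fun r hr => (h.critical _ (hm r hr)).loop.periodic, ?_⟩,
    by simp [h.center], ?_, by simp [h.center_period]⟩
  · exact h.smooth.comp (by fun_prop : ContDiff ℝ ∞ fun z : ℝ × ℝ =>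
      (κ + z.1, z.2)).contMDiff.contMDiffOn fun z hz => ⟨hm _ hz.1, mem_univ _⟩
  · exact h.smooth_period.comp (by fun_prop : ContDiff ℝ ∞ fun r : ℝ => κ + r).contDiffOn hm

variable [IsManifold (𝓡 n) ∞ M]

theorem IsSmoothLoop.exists_variation (hx : IsSmoothLoop n x) (T : ℝ) {v : PairField n x}
    (hv : IsFieldAlong x v.1) :
    ∃ (u : ℝ → ℝ → M) (θ : ℝ → ℝ), IsVariation n x u ∧ IsPeriodVariation T θ ∧
      HasVariationField x u v.1 ∧ deriv θ 0 = v.2 := by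
  obtain ⟨V, w, hw, -, h, -⟩ := (hx.isPairFamily T).exists_extension hv
  exact ⟨_, _, hw.exists_variation h⟩

/-- The condition over all variations is not vacuous because every smooth field has a variation, and
it reduces to one number because that variation does not matter. -/
theorem IsCriticalPoint.isNegativeFree_iff (hx : IsCriticalPoint L κ x T)
    (hL : ContMDiff (𝓡 n).tangent 𝓘(ℝ, ℝ) ∞ L) {N : Submodule ℝ (PairField n x)} :
    IsNegativeFree L κ x T N ↔ N ≤ admissible hx.loop ∧
      ∀ v ∈ N, v ≠ 0 → secondDifferential L κ x T v < 0 := by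
  refine ⟨fun h => ⟨h.tangent, fun v hv h0 => ?_⟩, fun h => ⟨h.1, fun v hv h0 u θ hu hθ h1 h2 => ?_⟩⟩
  · obtain ⟨u, θ, hu, hθ, h1, h2⟩ := hx.loop.exists_variation T (h.tangent v hv)
    rw [← hx.iteratedDeriv_two_eq_secondDifferential hL hu hθ h1 h2]
    exact h.negative v hv h0 u θ hu hθ h1 h2
  · rw [hx.iteratedDeriv_two_eq_secondDifferential hL hu hθ h1 h2]
    exact h.2 v hv h0

theorem IsCriticalPoint.isNegativeFixed_iff (hx : IsCriticalPoint L κ x T)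
    (hL : ContMDiff (𝓡 n).tangent 𝓘(ℝ, ℝ) ∞ L)
    {N : Submodule ℝ ((s : ℝ) → TangentSpace (𝓡 n) (x s))} :
    IsNegativeFixed L κ x T N ↔ (∀ ξ ∈ N, IsFieldAlong x ξ) ∧
      ∀ ξ ∈ N, ξ ≠ 0 → secondDifferential L κ x T (ξ, 0) < 0 := by
  have key : ∀ (ξ : (s : ℝ) → TangentSpace (𝓡 n) (x s)) (u : ℝ → ℝ → M), IsVariation n x u →
      HasVariationField x u ξ →
      iteratedDeriv 2 (fun r => action L κ (u r) T) 0 = secondDifferential L κ x T (ξ, 0) :=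
    fun ξ u hu h1 => hx.iteratedDeriv_two_eq_secondDifferential hL hu
      (isPeriodVariation_const T) h1 (by simp)
  refine ⟨fun h => ⟨h.tangent, fun ξ hξ h0 => ?_⟩, fun h => ⟨h.1, fun ξ hξ h0 u hu h1 => ?_⟩⟩
  · obtain ⟨u, θ, hu, hθ, h1, h2⟩ := hx.loop.exists_variation T (v := (ξ, 0)) (h.tangent ξ hξ)
    rw [← key ξ u hu h1]
    exact h.negative ξ hξ h0 u hu h1
  · rw [key ξ u hu h1]
    exact h.2 ξ hξ h0

/-- The period component of a tangent vector. -/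
def periodPart (hx : IsSmoothLoop n x) : admissible hx →ₗ[ℝ] ℝ :=
  (LinearMap.snd ℝ _ ℝ).comp (admissible hx).subtype

theorem IsCriticalPoint.bilinForm_self (hx : IsCriticalPoint L κ x T)
    (hL : ContMDiff (𝓡 n).tangent 𝓘(ℝ, ℝ) ∞ L) (v : admissible hx.loop) :
    hx.bilinForm hL v v = secondDifferential L κ x T v.1 :=
  hx.polarization_self hL v.2

theorem IsCriticalPoint.freeIndex_eq (hx : IsCriticalPoint L κ x T)
    (hL : ContMDiff (𝓡 n).tangent 𝓘(ℝ, ℝ) ∞ L) :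
    freeIndex L κ x T = negIndex (hx.bilinForm hL) ⊤ := by
  refine le_antisymm (sSup_le ?_) (sSup_le ?_)
  · rintro _ ⟨N, hN, hfd, rfl⟩
    rw [hx.isNegativeFree_iff hL] at hN
    have e := Submodule.submoduleOfEquivOfLe hN.1
    have : FiniteDimensional ℝ (N.submoduleOf (admissible hx.loop)) :=
      Module.Finite.equiv e.symm
    rw [← e.finrank_eq]
    refine IsNegDefOn.finrank_le ?_ le_top
    intro v hv h0
    rw [hx.bilinForm_self]
    exact hN.2 v.1 hv fun h => h0 (Subtype.ext h)
  · rintro _ ⟨N, -, hN, hfd, rfl⟩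
    refine le_sSup ⟨N.map (admissible hx.loop).subtype, (hx.isNegativeFree_iff hL).2
      ⟨Submodule.map_subtype_le _ _, ?_⟩, inferInstance, by rw [Submodule.finrank_map_subtype_eq]⟩
    rintro _ ⟨v, hv, rfl⟩ h0
    have h1 := hN v hv fun h => h0 (by rw [h, map_zero])
    rwa [hx.bilinForm_self] at h1

/-- The maps `ξ ↦ (ξ, 0)` and the first projection match negative subspaces on the two sides. -/
theorem IsCriticalPoint.fixedIndex_eq (hx : IsCriticalPoint L κ x T)
    (hL : ContMDiff (𝓡 n).tangent 𝓘(ℝ, ℝ) ∞ L) :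
    fixedIndex L κ x T = negIndex (hx.bilinForm hL) (LinearMap.ker (periodPart hx.loop)) := by
  refine le_antisymm (sSup_le ?_) (sSup_le ?_)
  · rintro _ ⟨N, hN, hfd, rfl⟩
    rw [hx.isNegativeFixed_iff hL] at hN
    set N' : Submodule ℝ (PairField n x) := N.map (LinearMap.inl ℝ _ ℝ)
    have hle : N' ≤ admissible hx.loop := by
      rintro _ ⟨ξ, hξ, rfl⟩
      exact hN.1 ξ hξ
    have e := (Submodule.equivMapOfInjective (LinearMap.inl ℝ
      ((s : ℝ) → TangentSpace (𝓡 n) (x s)) ℝ) LinearMap.inl_injective N).trans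
      (Submodule.submoduleOfEquivOfLe hle).symm
    have : FiniteDimensional ℝ (N'.submoduleOf (admissible hx.loop)) :=
      Module.Finite.equiv e
    rw [e.finrank_eq]
    refine IsNegDefOn.finrank_le ?_ ?_
    · rintro ⟨v, hv⟩ ⟨ξ, hξ, h⟩ h0
      obtain rfl : (ξ, 0) = v := h
      rw [hx.bilinForm_self]
      refine hN.2 ξ hξ fun h => h0 (Subtype.ext ?_)
      exact congrArg (fun ζ => (ζ, (0 : ℝ))) h
    · rintro ⟨v, hv⟩ ⟨ξ, hξ, h⟩
      obtain rfl : (ξ, 0) = v := h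
      rfl
  · rintro _ ⟨N, hle, hN, hfd, rfl⟩
    set f : admissible hx.loop →ₗ[ℝ] ((s : ℝ) → TangentSpace (𝓡 n) (x s)) :=
      (LinearMap.fst ℝ _ ℝ).comp (admissible hx.loop).subtype
    have hf : ∀ v ∈ N, (f v, (0 : ℝ)) = v.1 := fun v hv =>
      Prod.ext rfl (show (0 : ℝ) = periodPart hx.loop v from (hle hv).symm)
    have hinj : Function.Injective (f.domRestrict N) := by
      rintro ⟨v, hv⟩ ⟨v', hv'⟩ h
      refine Subtype.ext (Subtype.ext ?_)
      change v.1 = v'.1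
      rw [← hf v hv, ← hf v' hv', show f v = f v' from h]
    refine le_sSup ⟨N.map f, (hx.isNegativeFixed_iff hL).2 ⟨?_, ?_⟩, inferInstance, ?_⟩
    · rintro _ ⟨v, hv, rfl⟩
      exact v.2
    · rintro _ ⟨v, hv, rfl⟩ h0
      have h1 := hN v hv fun h => h0 (by rw [h, map_zero])
      rwa [hx.bilinForm_self, ← hf v hv] at h1
    · rw [← LinearMap.range_domRestrict, LinearMap.finrank_range_of_inj hinj]

theorem action_add (hL : ContMDiff (𝓡 n).tangent 𝓘(ℝ, ℝ) ∞ L) (hx : IsSmoothLoop n x) (κ c T : ℝ) :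
    action L (κ + c) x T = action L κ x T + c * T := by
  have hw := (hx.isPairFamily T).family
  have h1 := contMDiffOn_tangentMap hw.isOpen_prod hw.smooth (c := fun s : ℝ => (0, s))
    (c' := fun _ => (0, T⁻¹)) (V := univ) (by fun_prop) (by fun_prop)
    fun s _ => ⟨mem_univ _, mem_univ _⟩
  have h2 : Continuous fun s => L (scaledVelocity T⁻¹ x s) := by
    rw [← continuousOn_univ]
    refine ((hL.comp_contMDiffOn h1).congr fun s _ => ?_).continuousOn
    rw [hw.scaledVelocity_eq (p := (0 : ℝ)) (mem_univ _)]
    rfl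
  simp only [action]
  rw [intervalIntegral.integral_add (h2.intervalIntegrable 0 1) (by simp),
    intervalIntegral.integral_add (h2.intervalIntegrable 0 1) (by simp)]
  simp
  ring

/-- The velocity of an orbit cylinder represents, with respect to the second differential of the
action, minus the period component. -/
theorem IsOrbitCylinder.exists_velocity {ε : ℝ} {y : ℝ → ℝ → M} {p : ℝ → ℝ}
    (h : IsOrbitCylinder L κ x T ε y p) (hL : ContMDiff (𝓡 n).tangent 𝓘(ℝ, ℝ) ∞ L)
    (hx : IsCriticalPoint L κ x T) :
    ∃ η : PairField n x, IsFieldAlong x η.1 ∧ η.2 = deriv p κ ∧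
      ∀ v : PairField n x, IsFieldAlong x v.1 → polarization L κ x T η v = -v.2 := by
  have hw := h.isPairFamily
  set η : PairField n x := (fun s => (mfderiv 𝓘(ℝ, ℝ × ℝ) (𝓡 n)
    (fun z : ℝ × ℝ => y (κ + z.1) z.2) (0, s) ((1, 0) : ℝ × ℝ) : Model n), deriv p κ)
  have hη : HasPairVelocity (fun r => y (κ + r)) (fun r => p (κ + r)) (1 : ℝ) η := by
    refine hw.hasPairVelocity_iff.2 ⟨fun s => rfl, ?_⟩
    rw [fderiv_apply_one_eq_deriv, deriv_comp_const_add, add_zero]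
  refine ⟨η, hw.isFieldAlong hη, rfl, fun v hv => ?_⟩
  -- The cylinder gains a parameter in the direction `v`. The mixed second derivative at 0 is then
  -- computed twice: as the Hessian entry in `h1`, and from the criticality of the cylinder in `h2`.
  obtain ⟨V, w', hw', hrest, hv1, hext⟩ := hw.exists_extension hv
  rw [hx.polarization_eq hL hw' (hext _ _ hη) hv1]
  set θ' : ℝ × ℝ → ℝ := fun z => p (κ + z.1) + z.2 * v.2
  set G : ℝ × ℝ → ℝ := fun z => action L κ (w' z) (θ' z) with hG
  have hG2 : ContDiffAt ℝ 2 G 0 := (hw'.contDiffAt_action hL hx.pos).of_le two_le_infty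
  have hd : HasFDerivAt (fderiv ℝ G) (hessian L κ w' θ') ((0 : ℝ), (0 : ℝ)) :=
    ((hG2.fderiv_right (m := 1) (by norm_num)).differentiableAt (by simp)).hasFDerivAt
  have hc : HasDerivAt (fun k : ℝ => (k, (0 : ℝ))) (1, 0) 0 :=
    (hasDerivAt_id (0 : ℝ)).prodMk (hasDerivAt_const _ _)
  have h1 : HasDerivAt (fun k : ℝ => fderiv ℝ G (k, 0) (0, 1))
      (hessian L κ w' θ' (1, 0) (0, 1)) 0 := by
    simpa using (hd.comp_hasDerivAt (f := fun k : ℝ => (k, (0 : ℝ))) (0 : ℝ) hc).clm_apply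
      (hasDerivAt_const (0 : ℝ) ((0 : ℝ), (1 : ℝ)))
  have hct : ContinuousAt (fun k : ℝ => (k, (0 : ℝ))) 0 := by fun_prop
  -- The cylinder's member at `κ + k` is critical for the action at `κ + k`, which equals `G` plus
  -- `k` times the period; so the derivative of `G` in the new direction is `-k v.2`.
  have h2 : (fun k : ℝ => fderiv ℝ G (k, 0) (0, 1)) =ᶠ[𝓝 0] fun k => -(k * v.2) := by
    filter_upwards [hct.eventually_mem (hw'.family.isOpen.mem_nhds hw'.family.zero_mem),
      hct.eventually (hG2.eventually (by simp)),
      Ioo_mem_nhds (neg_lt_zero.2 h.pos) h.pos] with k hkV hkG hk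
    have hcrit := h.critical (κ + k) ⟨by linarith [hk.1], by linarith [hk.2]⟩
    have hcr : ContDiff ℝ ∞ fun r : ℝ => (k, r) := by fun_prop
    have hfam : IsFamily n ((fun r : ℝ => (k, r)) ⁻¹' V) (fun r => w' (k, r)) :=
      hw'.family.comp (hw'.family.isOpen.preimage hcr.continuous) hkV hcr.contDiffOn
        (mapsTo_preimage _ _)
    have hvar : IsVariation n (y (κ + k)) (fun r => w' (k, r)) := by
      rw [← hrest k hkV]
      exact hfam.isVariation
    have hper : IsPeriodVariation (p (κ + k)) (fun r => θ' (k, r)) :=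
      ⟨by simp [θ'], 1, one_pos, ContDiff.contDiffOn (by simp only [θ']; fun_prop)⟩
    have h3 := hcrit.critical _ _ hvar hper
    have h4 : (fun r => action L (κ + k) (w' (k, r)) (θ' (k, r))) =ᶠ[𝓝 0]
        fun r => G (k, r) + k * θ' (k, r) := by
      filter_upwards [hfam.isOpen.mem_nhds hfam.zero_mem] with r hr
      refine action_add hL ⟨?_, hfam.periodic r hr⟩ κ k _
      rw [← contMDiffOn_univ]
      exact hfam.smooth.comp (by fun_prop : ContDiff ℝ ∞ fun s : ℝ =>
        (r, s)).contMDiff.contMDiffOn fun s _ => ⟨hr, mem_univ _⟩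
    have h5 : HasDerivAt (fun r => G (k, r)) (fderiv ℝ G (k, 0) (0, 1)) 0 :=
      (hkG.differentiableAt (by simp)).hasFDerivAt.comp_hasDerivAt (f := fun r : ℝ => (k, r)) 0
        ((hasDerivAt_const _ _).prodMk (hasDerivAt_id _))
    have h6 : HasDerivAt (fun r => k * θ' (k, r)) (k * v.2) 0 := by
      simpa [θ'] using (((hasDerivAt_id (0 : ℝ)).mul_const v.2).const_add (p (κ + k))).const_mul k
    have h7 := (h5.fun_add h6).unique (h3.congr_of_eventuallyEq h4.symm)
    linarith
  have h3 : HasDerivAt (fun k : ℝ => -(k * v.2)) (-v.2) 0 := by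
    simpa using ((hasDerivAt_id (0 : ℝ)).mul_const v.2).fun_neg
  exact h1.unique (h3.congr_of_eventuallyEq h2)

/-- The relation between the free-period and the fixed-period Morse index in the presence of an
orbit cylinder. Non-degeneracy, which guarantees that an orbit cylinder exists, is not needed once
one is given. -/
theorem IsOrbitCylinder.freeIndex_eq {ε : ℝ} {y : ℝ → ℝ → M} {p : ℝ → ℝ}
    (h : IsOrbitCylinder L κ x T ε y p) (hL : ContMDiff (𝓡 n).tangent 𝓘(ℝ, ℝ) ∞ L)
    (hx : IsCriticalPoint L κ x T) :
    (0 ≤ deriv p κ → freeIndex L κ x T = fixedIndex L κ x T + 1) ∧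
      (deriv p κ < 0 → freeIndex L κ x T = fixedIndex L κ x T) := by
  obtain ⟨η, hη, hηp, hpol⟩ := h.exists_velocity hL hx
  rw [hx.freeIndex_eq hL, hx.fixedIndex_eq hL, ← hηp]
  have h0 : IsFieldAlong x (0 : PairField n x).1 := (admissible hx.loop).zero_mem
  -- The vector `e` is the zero field paired with a unit change of period.
  exact negIndex_top_eq (B := hx.bilinForm hL) (τ := periodPart hx.loop) (η := ⟨η, hη⟩) (e := ⟨(0, 1), h0⟩)
    (fun v w => polarization_comm v.1 w.1) (fun v => hpol v.1 v.2) rfl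

end Index

end FreePeriod

end

theorem proposition1p1 {n : ℕ} {M : Type*} [TopologicalSpace M] [T2Space M]
    [SecondCountableTopology M] [ChartedSpace (EuclideanSpace ℝ (Fin n)) M]
    [IsManifold (𝓡 n) ∞ M]
    (L : TangentBundle (𝓡 n) M → ℝ) (hL : FreePeriod.IsTonelli L)
    (κ₀ : ℝ) (x : ℝ → M) (T : ℝ)
    (hcrit : FreePeriod.IsCriticalPoint L κ₀ x T)
    (hnd : FreePeriod.IsTransversallyNondegenerate L x T)
    (ε : ℝ) (y : ℝ → ℝ → M) (P : ℝ → ℝ)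
    (hcyl : FreePeriod.IsOrbitCylinder L κ₀ x T ε y P) :
    (0 ≤ deriv P κ₀ →
      FreePeriod.freeIndex L κ₀ x T = FreePeriod.fixedIndex L κ₀ x T + 1) ∧
    (deriv P κ₀ < 0 →
      FreePeriod.freeIndex L κ₀ x T = FreePeriod.fixedIndex L κ₀ x T) := by
  exact hcyl.freeIndex_eq hL.smooth hcrit
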